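/- Throughout, $[a,b]=\{a,a+1,\dots,b\}$, $[n]=\{1,\dots,n\}$ and $\binom{[n]}{k}$ is the family of all $k$-element subsets of $[n]$. A family $\mathcal F\subseteq\binom{[n]}{k}$ is *$d$-wise intersecting* if $F_1\cap\dots\cap F_d\neq\emptyset$ for all $F_1,\dots,F_d\in\mathcal F$ (not necessarily distinct); it is *non-trivial* if no element of $[n]$ lies in all members of $\mathcal F$; a $d$-wise intersecting $\mathcal F\subseteq\binom{[n]}{k}$ is *maximal* if $\mathcal F\cup\{A\}$ is not $d$-wise intersecting for every $A\in\binom{[n]}{k}\setminus\mathcal F$. Two families $\mathcal F,\mathcal F'$ of subsets of $[n]$ are *isomorphic*, $\mathcal F\cong\mathcal F'$, if some permutation $\pi$ of $[n]$ satisfies $\{\pi(F):F\in\mathcal F\}=\mathcal F'$. For $k\ge d+1\ge 4$ and $2\le l\le k-d+2$ let $$\mathcal H(k,d,l)=\Big\{F\in\tbinom{[n]}{k}:[d-1]\subseteq F,\ F\cap[d,d+l-1]\ne\emptyset\Big\}\cup\Big\{F\in\tbinom{[n]}{k}:|[d-1]\cap F|=d-2,\ [d,d+l-1]\subseteq F\Big\},$$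 and let $$\begin{aligned}\mathcal G(k,d)=&\Big\{F\in\tbinom{[n]}{k}:[d-1]\subseteq F,\ F\cap[d,k-1]\ne\emptyset\Big\}\cup\{[2,k]\cup\{i\}:i\in[k+2,n]\}\\&\cup\Big\{F\in\tbinom{[n]}{k}:[d-1]\cup[k,k+1]\subseteq F\Big\}\cup\{[2,k-1]\cup\{k+1,i\}:i\in[k+2,n]\}\\&\cup\Big\{F\in\tbinom{[n]}{k}:|[d-1]\cap F|=d-2,\ [d,k+1]\subseteq F\Big\}.\end{aligned}$$ Write $\mathcal P=\{F\in\binom{[n]}{k}:[2]\subseteq F,\ F\cap[3,k-1]\neq\emptyset\}$. For $k\ge5$ let $$\begin{aligned}\mathcal S(k,3)=\;&\mathcal P\cup\Big\{F\in\tbinom{[n]}{k}:[2]\cup[k,k+2]\subseteq F\Big\}\\&\cup\bigcup_{i=1}^{2}\Big\{F\in\tbinom{[n]}{k}:\{i\}\cup[3,k-1]\subseteq F,\ |[k,k+2]\cap F|=2\Big\},\\ \mathcal S_1(k,3)=\;&\mathcal P\cup\Big\{F\in\tbinom{[n]}{k}:[2]\cup[k,k+2]\subseteq F\Big\}\cup\{[2,k]\cup\{i\}:i\in[k+1,n]\}\\&\cup\{[2,k+2]\setminus\{k\},\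 [k+1]\setminus\{2\},\ [k+2]\setminus\{2,k+1\}\},\end{aligned}$$ and for $k\ge6$ let $$\begin{aligned}\mathcal S_2(k,3)=\;&\mathcal P\cup\Big\{F\in\tbinom{[n]}{k}:[2]\cup[k,k+3]\subseteq F\Big\}\\&\cup\{[2,k+1],\ [2,k-1]\cup\{k+2,k+3\},\ [2,k]\cup\{k+3\},\ [2,k+2]\setminus\{k\}\}\\&\cup\{[3,k]\cup\{1,k+2\},\ [3,k-1]\cup\{1,k+1,k+3\}\},\\ \mathcal S_3(k,3)=\;&\mathcal P\cup\Big\{F\in\tbinom{[n]}{k}:[2]\cup[k,k+3]\subseteq F\Big\}\\&\cup\{[2,k]\cup\{k+2\},\ [2,k+2]\setminus\{k\},\ [2,k-1]\cup\{k+1,k+3\}\}\\&\cup\{[3,k+1]\cup\{1\},\ [3,k-1]\cup\{1,k+1,k+2\},\ [3,k-1]\cup\{1,k+2,k+3\}\}.\end{aligned}$$ **Theorem.** Let $k\ge d+2\ge5$ and $n>d+2(k-d)^2(k^{k-d}-1)^k\,k!$. Let $\mathcal F\subseteq\binom{[n]}{k}$ be a maximal non-trivial $d$-wise intersecting family with $|\mathcal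 F|>(k-d-\frac12)\binom{n-d}{k-d}$. Then: 1. If $k=5$ and $d=3$, then $\mathcal F$ is isomorphic to one of $\mathcal H(k,d,2)$, $\mathcal H(k,d,k-d)$, $\mathcal H(k,d,k-d+1)$, $\mathcal H(k,d,k-d+2)$, $\mathcal G(k,d)$, $\mathcal S(k,3)$, $\mathcal S_1(k,3)$. 2. If $k\in\{6,7\}$ and $d=3$, then $\mathcal F$ is isomorphic to one of $\mathcal H(k,d,2)$, $\mathcal H(k,d,k-d)$, $\mathcal H(k,d,k-d+1)$, $\mathcal H(k,d,k-d+2)$, $\mathcal G(k,d)$, $\mathcal S(k,3)$, $\mathcal S_1(k,3)$, $\mathcal S_2(k,3)$, $\mathcal S_3(k,3)$. 3. If $k>7$ and $d=3$, then $\mathcal F$ is isomorphic to one of $\mathcal H(k,d,k-d)$, $\mathcal H(k,d,k-d+1)$, $\mathcal H(k,d,k-d+2)$, $\mathcal G(k,d)$, $\mathcal S(k,3)$, $\mathcal S_1(k,3)$, $\mathcal S_2(k,3)$, $\mathcal S_3(k,3)$. 4. If $d+2\le k\le 2d+1$ and $d>3$, then $\mathcal F$ is isomorphic to one of $\mathcal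 H(k,d,2)$, $\mathcal H(k,d,k-d)$, $\mathcal H(k,d,k-d+1)$, $\mathcal H(k,d,k-d+2)$, $\mathcal G(k,d)$. 5. If $k>2d+1$ and $d>3$, then $\mathcal F$ is isomorphic to one of $\mathcal H(k,d,k-d)$, $\mathcal H(k,d,k-d+1)$, $\mathcal H(k,d,k-d+2)$, $\mathcal G(k,d)$. -/

import Mathlib

open Finset
open scoped Nat

namespace DWise

/-- The family of all `k`-element subsets of `[n] = {1, ..., n}`. -/
def uniform (n k : ℕ) : Finset (Finset ℕ) := powersetCard k (Icc 1 n)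

/-- Any `d` members of the family (repetitions allowed) have a common element. -/
def IsIntersecting (d : ℕ) (𝓕 : Finset (Finset ℕ)) : Prop :=
  ∀ A : Fin d → Finset ℕ, (∀ i, A i ∈ 𝓕) → ∃ x, ∀ i, x ∈ A i

/-- All members of the family contain a common element of `[n]`. -/
def IsTrivial (n : ℕ) (𝓕 : Finset (Finset ℕ)) : Prop :=
  ∃ x ∈ Icc 1 n, ∀ A ∈ 𝓕, x ∈ A

/-- A maximal non-trivial `d`-wise intersecting family of `k`-subsets of `[n]`: adding any
further `k`-subset of `[n]` destroys the `d`-wise intersecting property. -/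
structure IsMaximalNontrivial (n k d : ℕ) (𝓕 : Finset (Finset ℕ)) : Prop where
  subset_uniform : 𝓕 ⊆ uniform n k
  intersecting : IsIntersecting d 𝓕
  nontrivial : ¬ IsTrivial n 𝓕
  maximal : ∀ A ∈ uniform n k, A ∉ 𝓕 → ¬ IsIntersecting d (insert A 𝓕)

/-- Two families of subsets of `[n]` are isomorphic if a permutation of `[n]` carries one to
the other. Only the values of `π` on `[n]` matter. -/
def Iso (n : ℕ) (𝓕 𝓖 : Finset (Finset ℕ)) : Prop :=
  ∃ π : ℕ → ℕ, Set.BijOn π (Set.Icc 1 n) (Set.Icc 1 n) ∧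
    𝓕.image (fun A => A.image π) = 𝓖

/-- The family `H(k,d,l)` on `[n]`, for `k ≥ d + 1 ≥ 4` and `2 ≤ l ≤ k - d + 2`. -/
def H (n k d l : ℕ) : Finset (Finset ℕ) :=
  {F ∈ uniform n k | Icc 1 (d - 1) ⊆ F ∧ (F ∩ Icc d (d + l - 1)).Nonempty} ∪
  {F ∈ uniform n k | #(Icc 1 (d - 1) ∩ F) = d - 2 ∧ Icc d (d + l - 1) ⊆ F}

/-- The family `G(k,d)` on `[n]`, for `k ≥ d + 1 ≥ 4`. -/
def G (n k d : ℕ) : Finset (Finset ℕ) :=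
  {F ∈ uniform n k | Icc 1 (d - 1) ⊆ F ∧ (F ∩ Icc d (k - 1)).Nonempty} ∪
  (Icc (k + 2) n).image (fun i => Icc 2 k ∪ {i}) ∪
  {F ∈ uniform n k | Icc 1 (d - 1) ∪ Icc k (k + 1) ⊆ F} ∪
  (Icc (k + 2) n).image (fun i => Icc 2 (k - 1) ∪ {k + 1, i}) ∪
  {F ∈ uniform n k | #(Icc 1 (d - 1) ∩ F) = d - 2 ∧ Icc d (k + 1) ⊆ F}

/-- The family `S(k,3)` on `[n]`, for `k ≥ 5`. -/
def S (n k : ℕ) : Finset (Finset ℕ) :=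
  {F ∈ uniform n k | Icc 1 2 ⊆ F ∧ (F ∩ Icc 3 (k - 1)).Nonempty} ∪
  {F ∈ uniform n k | Icc 1 2 ∪ Icc k (k + 2) ⊆ F} ∪
  (Icc 1 2).biUnion (fun i =>
    {F ∈ uniform n k | {i} ∪ Icc 3 (k - 1) ⊆ F ∧ #(Icc k (k + 2) ∩ F) = 2})

/-- The family `S₁(k,3)` on `[n]`, for `k ≥ 5`. -/
def S₁ (n k : ℕ) : Finset (Finset ℕ) :=
  {F ∈ uniform n k | Icc 1 2 ⊆ F ∧ (F ∩ Icc 3 (k - 1)).Nonempty} ∪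
  {F ∈ uniform n k | Icc 1 2 ∪ Icc k (k + 2) ⊆ F} ∪
  (Icc (k + 1) n).image (fun i => Icc 2 k ∪ {i}) ∪
  {Icc 2 (k + 2) \ {k}, Icc 1 (k + 1) \ {2}, Icc 1 (k + 2) \ {2, k + 1}}

/-- The family `S₂(k,3)` on `[n]`, for `k ≥ 6`. -/
def S₂ (n k : ℕ) : Finset (Finset ℕ) :=
  {F ∈ uniform n k | Icc 1 2 ⊆ F ∧ (F ∩ Icc 3 (k - 1)).Nonempty} ∪
  {F ∈ uniform n k | Icc 1 2 ∪ Icc k (k + 3) ⊆ F} ∪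
  {Icc 2 (k + 1), Icc 2 (k - 1) ∪ {k + 2, k + 3}, Icc 2 k ∪ {k + 3}, Icc 2 (k + 2) \ {k}} ∪
  {Icc 3 k ∪ {1, k + 2}, Icc 3 (k - 1) ∪ {1, k + 1, k + 3}}

/-- The family `S₃(k,3)` on `[n]`, for `k ≥ 6`. -/
def S₃ (n k : ℕ) : Finset (Finset ℕ) :=
  {F ∈ uniform n k | Icc 1 2 ⊆ F ∧ (F ∩ Icc 3 (k - 1)).Nonempty} ∪
  {F ∈ uniform n k | Icc 1 2 ∪ Icc k (k + 3) ⊆ F} ∪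
  {Icc 2 k ∪ {k + 2}, Icc 2 (k + 2) \ {k}, Icc 2 (k - 1) ∪ {k + 1, k + 3}} ∪
  {Icc 3 (k + 1) ∪ {1}, Icc 3 (k - 1) ∪ {1, k + 1, k + 2}, Icc 3 (k - 1) ∪ {1, k + 2, k + 3}}

end DWise

/-!
Call a set a *cover* of `𝓕` if it meets the common part of any fewer than `d` members. By
maximality, the members are the `k`-sets that are covers, and by non-triviality a cover shares at
least `d - 1` elements with every member (`IsMaximalNontrivial.le_card_inter`).

A branching argument shows that the members containing no cover of size `d` contain one of at most
`k ^ (d + 1)` sets of size `d + 1`, so there are at most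
`k ^ (d + 1) * (n - d - 1).choose (k - d - 1)` of them, which for the given `n` is at most half of
`(n - d).choose (k - d)`. The size hypothesis therefore forces at least `k - d` covers of size `d`
(`le_card_smallCovers`).

These covers pairwise share `d - 1` elements. If they have no common core of size `d - 1`, they lie
in a set of size `d + 1` in which every member has `d` elements; then `𝓕` is `H(k,d,2)`, and there
are at most `d + 1` such covers, whence `k ≤ 2 * d + 1`. Otherwise they are the sets `X ∪ {y}`,
`y ∈ Y` (`IsCore`), and a member either contains `X`, or misses exactly one `x ∈ X` and
contains `Y`. If all members containing `X` meet `Y`, then `𝓕` is `H(k,d,#Y)`. If not, `#Y = k - d`,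
and the members missing `x` have two elements outside `X ∪ Y`, which gives a graph for every
`x ∈ X`. Any choice of one edge from each of these graphs has a common vertex, while no vertex
lies in all edges of all graphs, because it would yield another cover of size `d`. For at least
three graphs this determines the configuration of `G(k,d)` (`graphG_of_three_le`); for two graphs
it leaves the configurations of `G(k,3)` and of the four families `S` (`pairListed_of_cross`). The
members that contain `X` and miss `Y` contain every vertex that is the only common one of some
choice of edges, so `𝓕` embeds into the family in question, and by maximality it is that
family (`IsMaximalNontrivial.iso`).
-/

namespace DWise

/-! ### Covers and the number of members -/

lemma mem_uniform {n k : ℕ} {F : Finset ℕ} : F ∈ uniform n k ↔ F ⊆ Icc 1 n ∧ #F = k := by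
  simp [uniform, mem_powersetCard]

/-- The `d`-wise intersecting property, phrased for subfamilies with at most `d` members. -/
lemma isIntersecting_iff {d : ℕ} {𝓕 : Finset (Finset ℕ)} :
    IsIntersecting d 𝓕 ↔ ∀ s ⊆ 𝓕, #s ≤ d → ∃ x, ∀ A ∈ s, x ∈ A := by
  constructor
  · intro h s hs hsd
    rcases s.eq_empty_or_nonempty with rfl | ⟨A₀, hA₀⟩
    · exact ⟨0, by simp⟩
    obtain ⟨x, hx⟩ := h
      (fun i => if hi : (i : ℕ) < #s then (s.equivFin.symm ⟨i, hi⟩ : Finset ℕ) else A₀) (by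
        intro i
        split_ifs with hi
        · exact hs (s.equivFin.symm ⟨i, hi⟩).2
        · exact hs hA₀)
    refine ⟨x, fun A hA => ?_⟩
    have := hx ⟨(s.equivFin ⟨A, hA⟩ : ℕ), (s.equivFin ⟨A, hA⟩).2.trans_le hsd⟩
    simpa using this
  · intro h A hA
    obtain ⟨x, hx⟩ := h (univ.image A) (by
      intro B hB
      obtain ⟨i, -, rfl⟩ := mem_image.1 hB
      exact hA i) (card_image_le.trans (by simp))
    exact ⟨x, fun i => hx _ (mem_image_of_mem _ (mem_univ i))⟩

/-- A set `T` is a cover of `𝓕` if it meets the common part of any fewer than `d` members of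
`𝓕`; no bound on the size of `T` is imposed. -/
def IsCover (d : ℕ) (𝓕 : Finset (Finset ℕ)) (T : Finset ℕ) : Prop :=
  ∀ s ⊆ 𝓕, #s < d → ∃ x ∈ T, ∀ A ∈ s, x ∈ A

lemma IsCover.mono {d : ℕ} {𝓕 : Finset (Finset ℕ)} {T T' : Finset ℕ} (h : IsCover d 𝓕 T)
    (hT : T ⊆ T') : IsCover d 𝓕 T' := fun s hs hsd =>
  let ⟨x, hx, hxs⟩ := h s hs hsd
  ⟨x, hT hx, hxs⟩

lemma IsIntersecting.isCover {d : ℕ} {𝓕 : Finset (Finset ℕ)} (h : IsIntersecting d 𝓕)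
    {A : Finset ℕ} (hA : A ∈ 𝓕) : IsCover d 𝓕 A := by
  intro s hs hsd
  obtain ⟨x, hx⟩ := isIntersecting_iff.1 h (insert A s) (insert_subset hA hs)
    ((card_insert_le _ _).trans hsd)
  exact ⟨x, hx A (mem_insert_self _ _), fun B hB => hx B (mem_insert_of_mem hB)⟩

section Maximal

variable {n k d : ℕ} {𝓕 : Finset (Finset ℕ)}

/-- By maximality, every `k`-set containing a cover is a member. -/
lemma IsMaximalNontrivial.mem_of_isCover (h : IsMaximalNontrivial n k d 𝓕) {T A : Finset ℕ}
    (hT : IsCover d 𝓕 T) (hTA : T ⊆ A) (hA : A ∈ uniform n k) : A ∈ 𝓕 := by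
  by_contra hA𝓕
  refine h.maximal A hA hA𝓕 (isIntersecting_iff.2 fun s hs hsd => ?_)
  by_cases hAs : A ∈ s
  · obtain ⟨x, hx, hxs⟩ := hT (s.erase A)
      (fun B hB => (mem_insert.1 (hs (mem_of_mem_erase hB))).resolve_left (ne_of_mem_erase hB))
      ((card_erase_lt_of_mem hAs).trans_le hsd)
    refine ⟨x, fun B hB => ?_⟩
    by_cases hBA : B = A
    · exact hBA ▸ hTA hx
    · exact hxs B (mem_erase.2 ⟨hBA, hB⟩)
  · refine isIntersecting_iff.1 h.intersecting s (fun B hB => ?_) hsd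
    exact (mem_insert.1 (hs hB)).resolve_left (fun hBA => hAs (hBA ▸ hB))

lemma IsMaximalNontrivial.exists_notMem (h : IsMaximalNontrivial n k d 𝓕) {x : ℕ}
    (hx : x ∈ Icc 1 n) : ∃ F ∈ 𝓕, x ∉ F := by
  by_contra! hc
  exact h.nontrivial ⟨x, hx, hc⟩

/-- Non-triviality forces every cover to share at least `d - 1` elements with every member:
otherwise each common element is avoided by a further member, and too few members are used. -/
lemma IsMaximalNontrivial.le_card_inter (h : IsMaximalNontrivial n k d 𝓕) {T F : Finset ℕ}
    (hT : IsCover d 𝓕 T) (hF : F ∈ 𝓕) : d - 1 ≤ #(F ∩ T) := by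
  by_contra! hlt
  have hF' := (mem_uniform.1 (h.subset_uniform hF)).1
  have hex : ∀ x, ∃ G ∈ 𝓕, x ∈ F → x ∉ G := by
    intro x
    by_cases hx : x ∈ F
    · obtain ⟨G, hG, hxG⟩ := h.exists_notMem (hF' hx)
      exact ⟨G, hG, fun _ => hxG⟩
    · exact ⟨F, hF, fun h => absurd h hx⟩
  choose g hg hxg using hex
  obtain ⟨x, hxT, hx⟩ := hT (insert F ((F ∩ T).image g))
    (insert_subset hF (image_subset_iff.2 fun x _ => hg x)) (by
      have h1 := card_insert_le F ((F ∩ T).image g)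
      have h2 := card_image_le (s := F ∩ T) (f := g)
      omega)
  have hxF := hx F (mem_insert_self _ _)
  exact hxg x hxF (hx (g x) (mem_insert_of_mem (mem_image_of_mem g (mem_inter.2 ⟨hxF, hxT⟩))))

/-- Two covers of size `d` share at least `d - 1` elements: the first one is extended to a member
by elements outside the second one. -/
lemma IsMaximalNontrivial.le_card_inter_covers (h : IsMaximalNontrivial n k d 𝓕) (hdk : d ≤ k)
    (hn : 2 * k ≤ n) {T₁ T₂ : Finset ℕ} (h₁ : IsCover d 𝓕 T₁) (h₂ : IsCover d 𝓕 T₂)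
    (hT₁ : T₁ ∈ uniform n d) (hT₂ : T₂ ∈ uniform n d) : d - 1 ≤ #(T₁ ∩ T₂) := by
  rw [mem_uniform] at hT₁ hT₂
  obtain ⟨W, hW, hWc⟩ := exists_subset_card_eq (s := Icc 1 n \ (T₁ ∪ T₂)) (n := k - d) (by
    have h1 := le_card_sdiff (T₁ ∪ T₂) (Icc 1 n)
    have h2 := card_union_le T₁ T₂
    rw [Nat.card_Icc] at h1
    omega)
  have hdisj : Disjoint T₁ W := by
    rw [disjoint_left]
    intro x hx hxW
    have := hW hxW
    simp [hx] at this
  have hmem : T₁ ∪ W ∈ 𝓕 := by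
    refine h.mem_of_isCover h₁ subset_union_left (mem_uniform.2 ⟨union_subset hT₁.1 ?_, ?_⟩)
    · exact hW.trans sdiff_subset
    · rw [card_union_of_disjoint hdisj]
      omega
  have := h.le_card_inter h₂ hmem
  refine this.trans (card_le_card fun x hx => ?_)
  simp only [mem_inter, mem_union] at hx ⊢
  refine ⟨hx.1.resolve_right fun hxW => ?_, hx.2⟩
  have := hW hxW
  simp [hx.2] at this

/-- A set that is not a cover misses a set of at most `k` elements that every member meets. -/
lemma exists_blocker (h : IsMaximalNontrivial n k d 𝓕) (hd : 2 ≤ d) {C : Finset ℕ}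
    (hC : ¬ IsCover d 𝓕 C) :
    ∃ I : Finset ℕ, #I ≤ k ∧ Disjoint I C ∧ ∀ F ∈ 𝓕, ∃ x ∈ I, x ∈ F := by
  simp only [IsCover, not_forall] at hC
  obtain ⟨s, hs, hsd, hsC⟩ := hC
  have key : ∀ F ∈ 𝓕, ∃ x ∈ F, ∀ A ∈ s, x ∈ A := fun F hF => h.intersecting.isCover hF s hs hsd
  rcases s.eq_empty_or_nonempty with rfl | ⟨A, hA⟩
  · -- Only the empty set misses the common part of no members; any single member then serves.
    have hC0 : C = ∅ := by
      rw [eq_empty_iff_forall_notMem]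
      intro x hx
      exact hsC ⟨x, hx, by simp⟩
    rcases 𝓕.eq_empty_or_nonempty with rfl | ⟨A, hA⟩
    · exact ⟨∅, by simp, by simp, by simp⟩
    refine ⟨A, (mem_uniform.1 (h.subset_uniform hA)).2.le, by simp [hC0], fun F hF => ?_⟩
    obtain ⟨x, hx, hxA⟩ := h.intersecting.isCover hA {F} (by simpa using hF) (by rw [card_singleton]; omega)
    exact ⟨x, hx, hxA F (mem_singleton_self _)⟩
  · refine ⟨{x ∈ A | ∀ B ∈ s, x ∈ B}, ?_, ?_, fun F hF => ?_⟩
    · exact (card_le_card (filter_subset _ _)).trans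
        (mem_uniform.1 (h.subset_uniform (hs hA))).2.le
    · rw [disjoint_left]
      intro x hx hxC
      exact hsC ⟨x, hxC, (mem_filter.1 hx).2⟩
    · obtain ⟨x, hx, hxs⟩ := key F hF
      exact ⟨x, mem_filter.2 ⟨hxs A hA, hxs⟩, hx⟩

/-- Branching: as long as a partial choice of elements of a member is not a cover, one of at most
`k` further elements can be added to it. -/
lemma exists_branching (h : IsMaximalNontrivial n k d 𝓕) (hd : 2 ≤ d) (hdk : d ≤ k) (j : ℕ)
    (hj : j ≤ d + 1) :
    ∃ 𝓒 : Finset (Finset ℕ), #𝓒 ≤ k ^ j ∧ ∀ F ∈ 𝓕,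
      (∀ T ∈ uniform n d, IsCover d 𝓕 T → ¬ T ⊆ F) → ∃ C ∈ 𝓒, #C = j ∧ C ⊆ F := by
  induction j with
  | zero => exact ⟨{∅}, by simp, fun F _ _ => ⟨∅, by simp⟩⟩
  | succ j ih =>
    obtain ⟨𝓒, h𝓒, hF𝓒⟩ := ih (by omega)
    have hex : ∀ C : Finset ℕ, ∃ I : Finset ℕ, #I ≤ k ∧
        (¬ IsCover d 𝓕 C → Disjoint I C ∧ ∀ F ∈ 𝓕, ∃ x ∈ I, x ∈ F) := by
      intro C
      by_cases hC : IsCover d 𝓕 C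
      · exact ⟨∅, by simp, fun h => absurd hC h⟩
      · obtain ⟨I, hI⟩ := exists_blocker h hd hC
        exact ⟨I, hI.1, fun _ => hI.2⟩
    choose I hIk hI using hex
    refine ⟨𝓒.biUnion fun C => (I C).image (insert · C), ?_, fun F hF hno => ?_⟩
    · refine (card_biUnion_le_card_mul _ _ k fun C _ => card_image_le.trans (hIk C)).trans ?_
      rw [pow_succ]
      exact Nat.mul_le_mul_right _ h𝓒
    · obtain ⟨C, hC, hCj, hCF⟩ := hF𝓒 F hF hno
      have hFu := mem_uniform.1 (h.subset_uniform hF)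
      have hnc : ¬ IsCover d 𝓕 C := by
        intro hcov
        obtain ⟨T, hCT, hTF, hTd⟩ := exists_subsuperset_card_eq hCF (n := d) (by omega) (by omega)
        exact hno T (mem_uniform.2 ⟨hTF.trans hFu.1, hTd⟩) (hcov.mono hCT) hTF
      obtain ⟨hdis, hmeet⟩ := hI C hnc
      obtain ⟨x, hxI, hxF⟩ := hmeet F hF
      refine ⟨insert x C, mem_biUnion.2 ⟨C, hC, mem_image_of_mem _ hxI⟩, ?_,
        insert_subset hxF hCF⟩
      rw [card_insert_of_notMem (disjoint_left.1 hdis hxI), hCj]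

lemma card_supersets_le {n k : ℕ} (T : Finset ℕ) :
    #{F ∈ uniform n k | T ⊆ F} ≤ (n - #T).choose (k - #T) := by
  by_cases hT : T ⊆ Icc 1 n
  · have hc : #(powersetCard (k - #T) (Icc 1 n \ T)) = (n - #T).choose (k - #T) := by
      rw [card_powersetCard, card_sdiff_of_subset hT, Nat.card_Icc, Nat.add_sub_cancel]
    rw [← hc]
    refine card_le_card_of_injOn (· \ T) ?_ ?_
    · intro F hF
      rw [mem_coe, mem_filter, mem_uniform] at hF
      rw [mem_coe, mem_powersetCard]
      exact ⟨sdiff_subset_sdiff hF.1.1 le_rfl, by rw [card_sdiff_of_subset hF.2, hF.1.2]⟩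
    · intro F hF G hG hFG
      rw [mem_coe, mem_filter] at hF hG
      rw [← sdiff_union_of_subset hF.2, ← sdiff_union_of_subset hG.2]
      exact congrArg (· ∪ T) hFG
  · rw [filter_eq_empty_iff.2]
    · simp
    · intro F hF hTF
      exact hT (hTF.trans (mem_uniform.1 hF).1)

open Classical in
/-- The covers of size `d`. -/
noncomputable def smallCovers (n d : ℕ) (𝓕 : Finset (Finset ℕ)) : Finset (Finset ℕ) :=
  {T ∈ uniform n d | IsCover d 𝓕 T}

lemma mem_smallCovers {T : Finset ℕ} :
    T ∈ smallCovers n d 𝓕 ↔ T ∈ uniform n d ∧ IsCover d 𝓕 T := by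
  simp [smallCovers]

/-- Members containing no cover of size `d` have order of magnitude `n ^ (k - d - 1)` only. -/
lemma card_le_smallCovers (h : IsMaximalNontrivial n k d 𝓕) (hd : 2 ≤ d) (hdk : d ≤ k) :
    #𝓕 ≤ #(smallCovers n d 𝓕) * (n - d).choose (k - d) +
      k ^ (d + 1) * (n - (d + 1)).choose (k - (d + 1)) := by
  obtain ⟨𝓒, h𝓒, hF𝓒⟩ := exists_branching h hd hdk (d + 1) le_rfl
  have hsub : 𝓕 ⊆ (smallCovers n d 𝓕).biUnion (fun T => {F ∈ uniform n k | T ⊆ F}) ∪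
      ({C ∈ 𝓒 | #C = d + 1}).biUnion (fun T => {F ∈ uniform n k | T ⊆ F}) := by
    intro F hF
    have hFu := h.subset_uniform hF
    by_cases hno : ∀ T ∈ uniform n d, IsCover d 𝓕 T → ¬ T ⊆ F
    · obtain ⟨C, hC, hCd, hCF⟩ := hF𝓒 F hF hno
      exact mem_union_right _ (mem_biUnion.2
        ⟨C, mem_filter.2 ⟨hC, hCd⟩, mem_filter.2 ⟨hFu, hCF⟩⟩)
    · push Not at hno
      obtain ⟨T, hT, hTc, hTF⟩ := hno
      exact mem_union_left _ (mem_biUnion.2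
        ⟨T, mem_smallCovers.2 ⟨hT, hTc⟩, mem_filter.2 ⟨hFu, hTF⟩⟩)
  refine (card_le_card hsub).trans ((card_union_le _ _).trans (add_le_add ?_ ?_))
  · refine card_biUnion_le_card_mul _ _ _ fun T hT => (card_supersets_le T).trans ?_
    rw [(mem_uniform.1 (mem_smallCovers.1 hT).1).2]
  · refine (card_biUnion_le_card_mul _ _ _ fun T hT => (card_supersets_le T).trans ?_).trans
      (Nat.mul_le_mul_right _ ((card_le_card (filter_subset _ _)).trans h𝓒))
    rw [(mem_filter.1 hT).2]

lemma two_mul_pow_le (hdk : d + 2 ≤ k) :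
    2 * (k - d) * k ^ (d + 1) ≤ 2 * (k - d) ^ 2 * (k ^ (k - d) - 1) ^ k * k ! := by
  have h1 : k ≤ k ^ (k - d) - 1 := by
    have h2 : k ^ 2 ≤ k ^ (k - d) := Nat.pow_le_pow_right (by omega) (by omega)
    have h3 : k + 1 ≤ k ^ 2 := by nlinarith
    omega
  have h2 : k ^ (d + 1) ≤ (k ^ (k - d) - 1) ^ k :=
    (Nat.pow_le_pow_right (by omega) (by omega)).trans (Nat.pow_le_pow_left h1 k)
  have h3 : k - d ≤ (k - d) ^ 2 := Nat.le_self_pow (by omega) _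
  calc 2 * (k - d) * k ^ (d + 1) ≤ 2 * (k - d) ^ 2 * (k ^ (k - d) - 1) ^ k := by gcongr
    _ ≤ _ := Nat.le_mul_of_pos_right _ (Nat.factorial_pos k)

/-- A family above the size threshold has at least `k - d` covers of size `d`. -/
lemma le_card_smallCovers (h : IsMaximalNontrivial n k d 𝓕) (hd : 2 ≤ d) (hdk : d + 2 ≤ k)
    (hn : d + 2 * (k - d) * k ^ (d + 1) ≤ n)
    (hcard : ((k : ℝ) - (d : ℝ) - 1 / 2) * ((n - d).choose (k - d) : ℝ) < (#𝓕 : ℝ)) :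
    k - d ≤ #(smallCovers n d 𝓕) := by
  have h1 := card_le_smallCovers h hd (by omega)
  set m := #(smallCovers n d 𝓕)
  set N := n - d with hN
  have hNn : 2 * (k - d) * k ^ (d + 1) ≤ N := by omega
  have hNpos : 0 < N := by
    refine lt_of_lt_of_le ?_ hNn
    have : 0 < k ^ (d + 1) := pow_pos (by omega) _
    have : 0 < k - d := by omega
    positivity
  have h2 : 2 * (k ^ (d + 1) * (n - (d + 1)).choose (k - (d + 1))) ≤ N.choose (k - d) := by
    have h3 : N * (N - 1).choose (k - d - 1) = N.choose (k - d) * (k - d) := by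
      have := Nat.add_one_mul_choose_eq (N - 1) (k - d - 1)
      rwa [Nat.sub_add_cancel hNpos, Nat.sub_add_cancel (by omega)] at this
    rw [← Nat.sub_sub, ← Nat.sub_sub, ← hN]
    refine Nat.le_of_mul_le_mul_right (c := k - d) ?_ (by omega)
    calc _ = (2 * (k - d) * k ^ (d + 1)) * (N - 1).choose (k - d - 1) := by ring
      _ ≤ N * (N - 1).choose (k - d - 1) := Nat.mul_le_mul_right _ hNn
      _ = _ := h3
  by_contra! hlt
  have h4 : ((m : ℝ) + 1) ≤ k - d := by
    have : m + 1 + d ≤ k := by omega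
    have : ((m + 1 + d : ℕ) : ℝ) ≤ k := by exact_mod_cast this
    push_cast at this
    linarith
  have h5 : 2 * #𝓕 ≤ (2 * m + 1) * N.choose (k - d) := by
    calc 2 * #𝓕 ≤ 2 * (m * N.choose (k - d) +
        k ^ (d + 1) * (n - (d + 1)).choose (k - (d + 1))) := by omega
      _ ≤ _ := by rw [mul_add, add_mul]; linarith
  have h6 : (2 : ℝ) * #𝓕 ≤ (2 * m + 1) * N.choose (k - d) := by exact_mod_cast h5
  have h7 : (0 : ℝ) ≤ N.choose (k - d) := by positivity
  nlinarith [mul_le_mul_of_nonneg_right h4 h7]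

end Maximal

/-! ### Families of three shapes and their isomorphisms -/

/-- The three shapes of members around a core `X` and a set `Y`: the member contains `X` and meets
`Y`, or contains `X` and `U`, or misses exactly one element `x` of `X`, contains `Y`, and satisfies
a further condition `E x`. -/
def IsOfType (X Y U : Finset ℕ) (E : ℕ → Finset ℕ → Prop) (F : Finset ℕ) : Prop :=
  (X ⊆ F ∧ ∃ y ∈ Y, y ∈ F) ∨ (X ⊆ F ∧ U ⊆ F) ∨
    ∃ x ∈ X, x ∉ F ∧ X.erase x ⊆ F ∧ Y ⊆ F ∧ E x F

/-- If no element of `X` is common to all members of `s`, and every member of `s` misses at most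
one element of `X`, then members missing the different elements of `X` are different. -/
lemma exists_missing {X : Finset ℕ} {s : Finset (Finset ℕ)}
    (hs : ∀ F ∈ s, ∀ x ∈ X, x ∉ F → X.erase x ⊆ F) (hX : ∀ x ∈ X, ∃ F ∈ s, x ∉ F) :
    ∃ f : ℕ → Finset ℕ, (∀ x ∈ X, f x ∈ s ∧ x ∉ f x) ∧ #(X.image f) = #X := by
  have hex : ∀ x, ∃ F, x ∈ X → F ∈ s ∧ x ∉ F := by
    intro x
    by_cases hx : x ∈ X
    · obtain ⟨F, hF⟩ := hX x hx
      exact ⟨F, fun _ => hF⟩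
    · exact ⟨∅, fun h => absurd h hx⟩
  choose f hf using hex
  refine ⟨f, hf, card_image_of_injOn fun x hx y hy hxy => ?_⟩
  by_contra hne
  have h1 := hs (f x) (hf x hx).1 x hx (hf x hx).2 (mem_erase.2 ⟨Ne.symm hne, hy⟩)
  exact (hf y hy).2 (hxy ▸ h1)

/-- A family of sets of the three shapes is `d`-wise intersecting, where `d = #X + 1`, provided
that any members missing the different elements of `X` share an element of `U`. -/
lemma isIntersecting_of_isOfType {d : ℕ} {𝓖 : Finset (Finset ℕ)} {X Y U : Finset ℕ}
    {E : ℕ → Finset ℕ → Prop} (hX : #X + 1 = d) (hY : Y.Nonempty)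
    (h : ∀ F ∈ 𝓖, IsOfType X Y U E F)
    (hE : ∀ f : ℕ → Finset ℕ, (∀ x ∈ X, x ∉ f x ∧ X.erase x ⊆ f x ∧ Y ⊆ f x ∧ E x (f x)) →
      ∃ u ∈ U, ∀ x ∈ X, u ∈ f x) :
    IsIntersecting d 𝓖 := by
  have hmiss : ∀ F ∈ 𝓖, ∀ x ∈ X, x ∉ F → X.erase x ⊆ F ∧ Y ⊆ F ∧ E x F := by
    intro F hF x hx hxF
    rcases h F hF with h | h | ⟨z, hz, hzF, h1, h2, h3⟩
    · exact absurd (h.1 hx) hxF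
    · exact absurd (h.1 hx) hxF
    · obtain rfl : x = z := by
        by_contra hne
        exact hxF (h1 (mem_erase.2 ⟨hne, hx⟩))
      exact ⟨h1, h2, h3⟩
  rw [isIntersecting_iff]
  intro s hs hsd
  by_cases hcom : ∃ x ∈ X, ∀ F ∈ s, x ∈ F
  · obtain ⟨x, -, hx⟩ := hcom
    exact ⟨x, hx⟩
  push Not at hcom
  obtain ⟨f, hf, hfc⟩ := exists_missing (fun F hF x hx hxF => (hmiss F (hs hF) x hx hxF).1) hcom
  by_cases hall : ∀ F ∈ s, Y ⊆ F
  · obtain ⟨y, hy⟩ := hY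
    exact ⟨y, fun F hF => hall F hF hy⟩
  push Not at hall
  obtain ⟨G, hG, hYG⟩ := hall
  have hfG : ∀ x ∈ X, f x ≠ G := by
    rintro x hx rfl
    exact hYG (hmiss _ (hs hG) x hx (hf x hx).2).2.1
  -- The members `f x` and `G` are `#X + 1 = d` different members, hence all of `s`.
  have hs_eq : insert G (X.image f) = s := by
    refine eq_of_subset_of_card_le (insert_subset hG
      (image_subset_iff.2 fun x hx => (hf x hx).1)) ?_
    rw [card_insert_of_notMem, hfc]
    · omega
    · intro hmem
      obtain ⟨x, hx, hxG⟩ := mem_image.1 hmem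
      exact hfG x hx hxG
  have hfx : ∀ x ∈ X, x ∉ f x ∧ X.erase x ⊆ f x ∧ Y ⊆ f x ∧ E x (f x) := fun x hx =>
    ⟨(hf x hx).2, hmiss _ (hs (hf x hx).1) x hx (hf x hx).2⟩
  suffices ∃ u ∈ G, ∀ x ∈ X, u ∈ f x by
    obtain ⟨u, huG, hu⟩ := this
    refine ⟨u, fun F hF => ?_⟩
    rw [← hs_eq, mem_insert, mem_image] at hF
    rcases hF with rfl | ⟨x, hx, rfl⟩
    · exact huG
    · exact hu x hx
  rcases h G (hs hG) with ⟨-, y, hy, hyG⟩ | ⟨-, hU⟩ | ⟨z, hz, hzF, h1, h2, h3⟩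
  · exact ⟨y, hyG, fun x hx => (hfx x hx).2.2.1 hy⟩
  · obtain ⟨u, hu, hux⟩ := hE f hfx
    exact ⟨u, hU hu, hux⟩
  · exact absurd h2 hYG

lemma IsOfType.image {X Y U : Finset ℕ} {E E' : ℕ → Finset ℕ → Prop} {F : Finset ℕ}
    (h : IsOfType X Y U E F) (π : Equiv.Perm ℕ)
    (hE : ∀ x ∈ X, x ∉ F → E x F → E' (π x) (F.image π)) :
    IsOfType (X.image π) (Y.image π) (U.image π) E' (F.image π) := by
  rcases h with ⟨h, y, hy, hyF⟩ | ⟨h, hU⟩ | ⟨z, hz, hzF, h1, h2, h3⟩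
  · exact Or.inl ⟨image_subset_image h, π y, mem_image_of_mem _ hy, mem_image_of_mem _ hyF⟩
  · exact Or.inr (Or.inl ⟨image_subset_image h, image_subset_image hU⟩)
  · refine Or.inr (Or.inr ⟨π z, mem_image_of_mem _ hz, ?_, ?_, image_subset_image h2,
      hE z hz hzF h3⟩)
    · simpa [mem_image] using hzF
    · rw [← image_erase π.injective]
      exact image_subset_image h1

/-- A permutation carrying a maximal family into a `d`-wise intersecting family carries it onto
that family. -/
lemma IsMaximalNontrivial.iso {n k d : ℕ} {𝓕 𝓖 : Finset (Finset ℕ)}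
    (h : IsMaximalNontrivial n k d 𝓕) (π : Equiv.Perm ℕ)
    (hπ : ∀ x, π x ∈ Icc 1 n ↔ x ∈ Icc 1 n) (h𝓖 : 𝓖 ⊆ uniform n k) (hi : IsIntersecting d 𝓖)
    (hF : ∀ F ∈ 𝓕, F.image π ∈ 𝓖) : Iso n 𝓕 𝓖 := by
  refine ⟨π, ⟨fun x hx => ?_, π.injective.injOn, fun x hx => ⟨π.symm x, ?_, by simp⟩⟩, ?_⟩
  · have := hπ x
    simp only [mem_Icc] at this
    exact this.2 hx
  · have := hπ (π.symm x)
    simp only [mem_Icc, Equiv.apply_symm_apply] at this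
    exact this.1 hx
  refine Subset.antisymm (image_subset_iff.2 hF) fun B hB => ?_
  have hBu := mem_uniform.1 (h𝓖 hB)
  have hBi : (B.image π.symm).image π = B := by simp [image_image]
  refine mem_image.2 ⟨B.image π.symm, ?_, hBi⟩
  by_contra hBF
  refine h.maximal _ (mem_uniform.2 ⟨image_subset_iff.2 fun x hx => ?_, ?_⟩) hBF ?_
  · rw [← hπ, Equiv.apply_symm_apply]
    exact hBu.1 hx
  · rw [card_image_of_injective _ π.symm.injective, hBu.2]
  · intro A hA
    obtain ⟨x, hx⟩ := hi (fun i => (A i).image π) fun i => by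
      rcases mem_insert.1 (hA i) with hAi | hAi
      · rw [hAi, hBi]
        exact hB
      · exact hF _ hAi
    refine ⟨π.symm x, fun i => ?_⟩
    obtain ⟨y, hy, rfl⟩ := mem_image.1 (hx i)
    simpa using hy

/-- A permutation of `[n]` fixing `[m]` pointwise and pushing `Z` to the interval after `m`. -/
lemma exists_perm_interval {n m : ℕ} {Z : Finset ℕ} (hZ : Z ⊆ Icc (m + 1) n) :
    ∃ π : Equiv.Perm ℕ, (∀ x, π x ∈ Icc (m + 1) n ↔ x ∈ Icc (m + 1) n) ∧
      (∀ x, x ∉ Icc (m + 1) n → π x = x) ∧ Z.image π = Icc (m + 1) (m + #Z) := by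
  induction Z using Finset.induction_on with
  | empty => exact ⟨1, by simp⟩
  | insert z Z hz ih =>
    obtain ⟨π, h1, h2, h3⟩ := ih ((subset_insert _ _).trans hZ)
    have hzn : π z ∈ Icc (m + 1) n := (h1 z).2 (hZ (mem_insert_self _ _))
    have hzI : π z ∉ Icc (m + 1) (m + #Z) := by
      rw [← h3]
      simpa [mem_image] using hz
    have hq : m + #Z + 1 ≤ π z ∧ π z ≤ n := by
      rw [mem_Icc] at hzn hzI
      omega
    have hsw : ∀ y, Equiv.swap (π z) (m + #Z + 1) y =
        if y = π z then m + #Z + 1 else if y = m + #Z + 1 then π z else y :=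
      fun y => Equiv.swap_apply_def _ _ _
    refine ⟨π.trans (Equiv.swap (π z) (m + #Z + 1)), fun x => ?_, fun x hx => ?_, ?_⟩
    · rw [← h1 x, Equiv.trans_apply, hsw]
      simp only [mem_Icc]
      split_ifs <;> omega
    · rw [Equiv.trans_apply, h2 x hx, hsw]
      rw [mem_Icc] at hx
      split_ifs <;> omega
    · rw [image_insert, card_insert_of_notMem hz, Equiv.trans_apply, Equiv.swap_apply_left]
      have h4 : Z.image (π.trans (Equiv.swap (π z) (m + #Z + 1))) = Icc (m + 1) (m + #Z) := by
        rw [← h3]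
        refine image_congr fun x hx => ?_
        have hx' : π x ∈ Icc (m + 1) (m + #Z) := h3 ▸ mem_image_of_mem _ hx
        have hne : π x ≠ π z := fun h => hzI (h ▸ hx')
        rw [mem_Icc] at hx'
        rw [Equiv.trans_apply, hsw, if_neg hne, if_neg (by omega)]
      rw [h4]
      ext x
      simp only [mem_insert, mem_Icc]
      omega

/-- The images of the sets in the list `L` under `π` are the consecutive intervals after `m`. -/
def IsStacking (π : Equiv.Perm ℕ) : ℕ → List (Finset ℕ) → Prop
  | _, [] => True
  | m, Z :: L => Z.image π = Icc (m + 1) (m + #Z) ∧ IsStacking π (m + #Z) L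

/-- The inductive form of `exists_stacking`: the sets are moved one after another, starting from a
permutation `π₀` that is kept wherever its values are at most `m`. -/
lemma exists_stacking_from (n : ℕ) (L : List (Finset ℕ)) (m : ℕ) (π₀ : Equiv.Perm ℕ)
    (hL : ∀ Z ∈ L, Z.image π₀ ⊆ Icc (m + 1) n) (hd : L.Pairwise Disjoint) :
    ∃ π : Equiv.Perm ℕ, (∀ x, π x ∈ Icc 1 n ↔ π₀ x ∈ Icc 1 n) ∧
      (∀ x, π₀ x ≤ m → π x = π₀ x) ∧ IsStacking π m L := by
  induction L generalizing m π₀ with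
  | nil => exact ⟨π₀, by simp [IsStacking]⟩
  | cons Z L ih =>
    obtain ⟨ρ, h1, h2, h3⟩ := exists_perm_interval (hL Z List.mem_cons_self)
    rw [card_image_of_injective _ π₀.injective, image_image] at h3
    rw [List.pairwise_cons] at hd
    have hL' : ∀ Z' ∈ L, Z'.image (π₀.trans ρ) ⊆ Icc (m + #Z + 1) n := by
      intro Z' hZ' y hy
      obtain ⟨x, hx, rfl⟩ := mem_image.1 hy
      have hx1 : ρ (π₀ x) ∈ Icc (m + 1) n :=
        (h1 _).2 (hL Z' (List.mem_cons_of_mem _ hZ') (mem_image_of_mem _ hx))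
      have hx2 : ρ (π₀ x) ∉ Icc (m + 1) (m + #Z) := by
        rw [← h3]
        intro hmem
        obtain ⟨z, hz, hzx⟩ := mem_image.1 hmem
        have : z = x := π₀.injective (ρ.injective hzx)
        exact disjoint_left.1 (hd.1 Z' hZ') (this ▸ hz) hx
      rw [Equiv.trans_apply]
      rw [mem_Icc] at hx1 hx2 ⊢
      omega
    obtain ⟨π, h4, h5, h6⟩ := ih (m + #Z) (π₀.trans ρ) hL' hd.2
    refine ⟨π, fun x => ?_, fun x hx => ?_, ?_, h6⟩
    · rw [h4, Equiv.trans_apply]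
      have e1 := h1 (π₀ x)
      have e2 := h2 (π₀ x)
      simp only [mem_Icc] at e1 e2 ⊢
      by_cases hx : m + 1 ≤ π₀ x ∧ π₀ x ≤ n
      · have := e1.2 hx
        omega
      · rw [e2 hx]
    · have e2 := h2 (π₀ x) (by rw [mem_Icc]; omega)
      have e5 := h5 x
      rw [Equiv.trans_apply, e2] at e5
      exact e5 (by omega)
    · rw [← h3]
      refine image_congr fun x hx => ?_
      have hx' : ρ (π₀ x) ∈ Icc (m + 1) (m + #Z) := h3 ▸ mem_image_of_mem (ρ ∘ π₀) hx
      rw [mem_Icc] at hx'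
      exact h5 x hx'.2

/-- Pairwise disjoint subsets of `[n]` can be moved to consecutive intervals. -/
lemma exists_stacking (n : ℕ) (L : List (Finset ℕ)) (hL : ∀ Z ∈ L, Z ⊆ Icc 1 n)
    (hd : L.Pairwise Disjoint) :
    ∃ π : Equiv.Perm ℕ, (∀ x, π x ∈ Icc 1 n ↔ x ∈ Icc 1 n) ∧ IsStacking π 0 L := by
  obtain ⟨π, h1, -, h2⟩ := exists_stacking_from n L 0 1 (by simpa using hL) hd
  exact ⟨π, h1, h2⟩

/-! ### Membership in the listed families -/

section Families
variable {n k d l : ℕ} {F : Finset ℕ}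

lemma eq_of_subset_of_mem_uniform {T : Finset ℕ} (hF : F ∈ uniform n k) (h : T ⊆ F)
    (hT : k ≤ #T) : F = T :=
  (eq_of_subset_of_card_le h ((mem_uniform.1 hF).2.trans_le hT)).symm

/-- A set meeting `X` in all but one of its elements misses exactly one element of `X`. -/
lemma card_inter_eq_iff {X : Finset ℕ} (hX : X.Nonempty) :
    #(X ∩ F) = #X - 1 ↔ ∃ x ∈ X, x ∉ F ∧ X.erase x ⊆ F := by
  constructor
  · intro h
    have h1 : #(X \ F) = 1 := by
      have := card_sdiff_add_card_inter X F
      have := hX.card_pos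
      omega
    obtain ⟨x, hx⟩ := card_eq_one.1 h1
    have hx' : ∀ y, y ∈ X \ F ↔ y = x := fun y => by rw [hx, mem_singleton]
    simp only [mem_sdiff] at hx'
    refine ⟨x, ((hx' x).2 rfl).1, ((hx' x).2 rfl).2, fun y hy => ?_⟩
    by_contra hyF
    exact (mem_erase.1 hy).1 ((hx' y).1 ⟨(mem_erase.1 hy).2, hyF⟩)
  · rintro ⟨x, hx, hxF, h⟩
    rw [← card_erase_of_mem hx]
    congr 1
    ext y
    simp only [mem_inter, mem_erase]
    exact ⟨fun hy => ⟨fun e => hxF (e ▸ hy.2), hy.1⟩, fun hy => ⟨hy.2, h (mem_erase.2 hy)⟩⟩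

lemma exists_eq_union_singleton {T : Finset ℕ} (hF : F ∈ uniform n k) (h : T ⊆ F)
    (hT : #T + 1 = k) : ∃ i ∈ F, i ∉ T ∧ F = T ∪ {i} := by
  obtain ⟨i, hi⟩ := card_eq_one.1 (show #(F \ T) = 1 by
    rw [card_sdiff_of_subset h, (mem_uniform.1 hF).2]
    omega)
  have hi' : i ∈ F \ T := by rw [hi, mem_singleton]
  rw [mem_sdiff] at hi'
  exact ⟨i, hi'.1, hi'.2, by rw [← hi, union_sdiff_of_subset h]⟩

lemma card_Icc_one_inter_eq_iff (hd : 2 ≤ d) : #(Icc 1 (d - 1) ∩ F) = d - 2 ↔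
    ∃ x ∈ Icc 1 (d - 1), x ∉ F ∧ (Icc 1 (d - 1)).erase x ⊆ F := by
  rw [← card_inter_eq_iff (nonempty_Icc.2 (by omega)), Nat.card_Icc]
  omega

lemma mem_H_iff (hd : 2 ≤ d) (hl : 1 ≤ l) : F ∈ H n k d l ↔ F ∈ uniform n k ∧
    IsOfType (Icc 1 (d - 1)) (Icc d (d + l - 1)) (Icc d (d + l - 1)) (fun _ _ => True) F := by
  rw [H, mem_union, mem_filter, mem_filter, card_Icc_one_inter_eq_iff hd, ← and_or_left]
  refine and_congr_right fun hF => ⟨?_, ?_⟩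
  · rintro (⟨h, y, hy⟩ | ⟨⟨x, hx, hxF, h⟩, h'⟩)
    · rw [mem_inter] at hy
      exact Or.inl ⟨h, y, hy.2, hy.1⟩
    · exact Or.inr (Or.inr ⟨x, hx, hxF, h, h', trivial⟩)
  · rintro (⟨h, y, hy, hyF⟩ | ⟨h, h'⟩ | ⟨x, hx, hxF, h, h', -⟩)
    · exact Or.inl ⟨h, y, mem_inter.2 ⟨hyF, hy⟩⟩
    · have hmem : d ∈ Icc d (d + l - 1) := mem_Icc.2 (by omega)
      exact Or.inl ⟨h, d, mem_inter.2 ⟨h' hmem, hmem⟩⟩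
    · exact Or.inr ⟨⟨x, hx, hxF, h⟩, h'⟩

/-- The condition on a member of `G(k,d)` missing `x ∈ [d-1]`. -/
def EG (k x : ℕ) (F : Finset ℕ) : Prop :=
  (x = 1 ∧ (k ∈ F ∨ k + 1 ∈ F)) ∨ (k ∈ F ∧ k + 1 ∈ F)

lemma EG_of_type_G (hk : d + 1 ≤ k) (hd : 3 ≤ d) {j : ℕ} (hj : j = k ∨ j = k + 1)
    (hF : F ∈ uniform n k) (h : Icc 2 (k - 1) ⊆ F) (hjF : j ∈ F) (h1 : 1 ∉ F) :
    IsOfType (Icc 1 (d - 1)) (Icc d (k - 1)) {k, k + 1} (EG k) F := by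
  refine Or.inr (Or.inr ⟨1, mem_Icc.2 (by omega), h1, fun x hx => h ?_, fun x hx => h ?_, ?_⟩)
  · rw [mem_erase, mem_Icc] at hx
    exact mem_Icc.2 (by omega)
  · rw [mem_Icc] at hx
    exact mem_Icc.2 (by omega)
  · rcases hj with rfl | rfl
    · exact Or.inl ⟨rfl, Or.inl hjF⟩
    · exact Or.inl ⟨rfl, Or.inr hjF⟩

lemma mem_G_iff (hd : 3 ≤ d) (hk : d + 1 ≤ k) : F ∈ G n k d ↔ F ∈ uniform n k ∧
    IsOfType (Icc 1 (d - 1)) (Icc d (k - 1)) {k, k + 1} (EG k) F := by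
  have hu : ∀ i ∈ Icc (k + 2) n, ∀ j, j = k ∨ j = k + 1 →
      insert j (insert i (Icc 2 (k - 1))) ∈ uniform n k := by
    intro i hi j hj
    rw [mem_Icc] at hi
    rw [mem_uniform, card_insert_of_notMem, card_insert_of_notMem, Nat.card_Icc]
    · refine ⟨fun x => ?_, by omega⟩
      simp only [mem_insert, mem_Icc]
      omega
    all_goals simp only [mem_insert, mem_Icc]; omega
  have e1 : ∀ i, Icc 2 k ∪ {i} = insert k (insert i (Icc 2 (k - 1))) := by
    intro i
    ext x; simp only [mem_union, mem_insert, mem_singleton, mem_Icc]; omega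
  have e2 : ∀ i, Icc 2 (k - 1) ∪ {k + 1, i} = insert (k + 1) (insert i (Icc 2 (k - 1))) := by
    intro i
    ext x; simp only [mem_union, mem_insert, mem_singleton, mem_Icc]; omega
  have hsub : ∀ i j, Icc 2 (k - 1) ⊆ insert j (insert i (Icc 2 (k - 1))) := fun i j x hx =>
    mem_insert_of_mem (mem_insert_of_mem hx)
  simp only [G, mem_union, mem_filter, mem_image, card_Icc_one_inter_eq_iff (show 2 ≤ d by omega),
    e1, e2]
  constructor
  · rintro ((((⟨hF, h, y, hy⟩ | ⟨i, hi, rfl⟩) | ⟨hF, h⟩) | ⟨i, hi, rfl⟩) |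
      ⟨hF, ⟨x, hx, hxF, h⟩, h'⟩)
    · rw [mem_inter] at hy
      exact ⟨hF, Or.inl ⟨h, y, hy.2, hy.1⟩⟩
    · refine ⟨hu i hi k (by omega), EG_of_type_G hk hd (j := k) (by omega) (hu i hi k (by omega))
        (hsub _ _) (mem_insert_self _ _) ?_⟩
      rw [mem_Icc] at hi
      simp only [mem_insert, mem_Icc]
      omega
    · refine ⟨hF, Or.inr (Or.inl ⟨(union_subset_iff.1 h).1, ?_⟩)⟩
      exact insert_subset (h (by simp)) (singleton_subset_iff.2 (h (by simp)))
    · refine ⟨hu i hi (k + 1) (by omega), EG_of_type_G hk hd (j := k + 1) (by omega)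
        (hu i hi (k + 1) (by omega)) (hsub _ _) (mem_insert_self _ _) ?_⟩
      rw [mem_Icc] at hi
      simp only [mem_insert, mem_Icc]
      omega
    · refine ⟨hF, Or.inr (Or.inr ⟨x, hx, hxF, h, (Icc_subset_Icc_right (by omega)).trans h',
        Or.inr ⟨h' ?_, h' ?_⟩⟩)⟩ <;> exact mem_Icc.2 (by omega)
  · rintro ⟨hF, ⟨h, y, hy, hyF⟩ | ⟨h, h'⟩ | ⟨x, hx, hxF, h, h', hE⟩⟩
    · exact Or.inl (Or.inl (Or.inl (Or.inl ⟨hF, h, y, mem_inter.2 ⟨hyF, hy⟩⟩)))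
    · refine Or.inl (Or.inl (Or.inr ⟨hF, union_subset h fun x hx => h' ?_⟩))
      rw [mem_Icc] at hx
      rw [mem_insert, mem_singleton]
      omega
    · by_cases hb : k ∈ F ∧ k + 1 ∈ F
      · refine Or.inr ⟨hF, ⟨x, hx, hxF, h⟩, fun y hy => ?_⟩
        rw [mem_Icc] at hy
        obtain rfl | rfl | hy' : y = k ∨ y = k + 1 ∨ (d ≤ y ∧ y ≤ k - 1) := by omega
        · exact hb.1
        · exact hb.2
        · exact h' (mem_Icc.2 hy')
      obtain ⟨rfl, hE'⟩ := hE.resolve_right hb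
      have hsubF : ∀ y, 2 ≤ y → y ≤ k - 1 → y ∈ F := by
        intro y hy2 hyk
        by_cases hyd : y < d
        · exact h (mem_erase.2 ⟨by omega, mem_Icc.2 (by omega)⟩)
        · exact h' (mem_Icc.2 (by omega))
      -- One of `k`, `k + 1` lies in `F`, which leaves a single further element `i ≥ k + 2`.
      have hex : ∀ j, (j = k ∨ j = k + 1) → j ∈ F →
          ∃ i ∈ Icc (k + 2) n, insert j (insert i (Icc 2 (k - 1))) = F := by
        intro j hj hjF
        obtain ⟨i, hiF, hi, hFi⟩ := exists_eq_union_singleton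
          (T := insert j (Icc 2 (k - 1))) hF (insert_subset hjF fun y hy => by
            rw [mem_Icc] at hy
            exact hsubF y hy.1 hy.2) (by
            rw [card_insert_of_notMem, Nat.card_Icc]
            · omega
            · rw [mem_Icc]
              omega)
        refine ⟨i, ?_, ?_⟩
        · have hin := (mem_uniform.1 hF).1 hiF
          have hi1 : i ≠ 1 := fun h => hxF (h ▸ hiF)
          have hi2 : ¬ (i = k ∧ j = k + 1) := by
            rintro ⟨rfl, rfl⟩
            exact hb ⟨hiF, hjF⟩
          have hi3 : ¬ (i = k + 1 ∧ j = k) := by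
            rintro ⟨rfl, rfl⟩
            exact hb ⟨hjF, hiF⟩
          rw [mem_insert, mem_Icc] at hi
          rw [mem_Icc] at hin ⊢
          omega
        · rw [hFi]
          ext y
          simp only [mem_insert, mem_union, mem_singleton]
          tauto
      rcases hE' with hE' | hE'
      · exact Or.inl (Or.inl (Or.inl (Or.inr (hex k (Or.inl rfl) hE'))))
      · exact Or.inl (Or.inr (hex (k + 1) (Or.inr rfl) hE'))

/-- The condition on a member of `S(k,3)` missing an element of `[2]`. -/
def ES (k : ℕ) (_ : ℕ) (F : Finset ℕ) : Prop :=
  (k ∈ F ∧ k + 1 ∈ F) ∨ (k ∈ F ∧ k + 2 ∈ F) ∨ (k + 1 ∈ F ∧ k + 2 ∈ F)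

/-- The condition on a member of `S₁(k,3)` missing `x ∈ [2]`. -/
def ES₁ (k x : ℕ) (F : Finset ℕ) : Prop :=
  (x = 1 ∧ (k ∈ F ∨ (k + 1 ∈ F ∧ k + 2 ∈ F))) ∨
    (x = 2 ∧ k ∈ F ∧ (k + 1 ∈ F ∨ k + 2 ∈ F))

/-- The condition on a member of `S₂(k,3)` missing `x ∈ [2]`. -/
def ES₂ (k x : ℕ) (F : Finset ℕ) : Prop :=
  (x = 1 ∧ ((k ∈ F ∧ k + 1 ∈ F) ∨ (k + 2 ∈ F ∧ k + 3 ∈ F) ∨ (k ∈ F ∧ k + 3 ∈ F) ∨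
    (k + 1 ∈ F ∧ k + 2 ∈ F))) ∨
    (x = 2 ∧ ((k ∈ F ∧ k + 2 ∈ F) ∨ (k + 1 ∈ F ∧ k + 3 ∈ F)))

/-- The condition on a member of `S₃(k,3)` missing `x ∈ [2]`. -/
def ES₃ (k x : ℕ) (F : Finset ℕ) : Prop :=
  (x = 1 ∧ ((k ∈ F ∧ k + 2 ∈ F) ∨ (k + 1 ∈ F ∧ k + 2 ∈ F) ∨ (k + 1 ∈ F ∧ k + 3 ∈ F))) ∨
    (x = 2 ∧ ((k ∈ F ∧ k + 1 ∈ F) ∨ (k + 1 ∈ F ∧ k + 2 ∈ F) ∨ (k + 2 ∈ F ∧ k + 3 ∈ F)))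

lemma isOfType_two_iff {Y U : Finset ℕ} {E : ℕ → Finset ℕ → Prop} :
    IsOfType (Icc 1 2) Y U E F ↔ (Icc 1 2 ⊆ F ∧ (F ∩ Y).Nonempty) ∨ (Icc 1 2 ∪ U ⊆ F) ∨
      (1 ∉ F ∧ 2 ∈ F ∧ Y ⊆ F ∧ E 1 F) ∨ (2 ∉ F ∧ 1 ∈ F ∧ Y ⊆ F ∧ E 2 F) := by
  have h1 : (Icc 1 2).erase 1 = {2} := by decide
  have h2 : (Icc 1 2).erase 2 = {1} := by decide
  have h3 : ∀ x, x ∈ Icc 1 2 ↔ x = 1 ∨ x = 2 := fun x => by rw [mem_Icc]; omega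
  simp only [IsOfType, union_subset_iff, h3, exists_eq_or_imp, exists_eq_left, h1, h2,
    singleton_subset_iff, Finset.Nonempty, mem_inter, and_comm (a := _ ∈ F) (b := _ ∈ Y)]

/-- The set consisting of one element `c` of `[2]`, the interval `[3,k-1]`, and `p`, `q`. -/
def pairSet (k c p q : ℕ) : Finset ℕ := insert c (insert p (insert q (Icc 3 (k - 1))))

lemma eq_pairSet_iff_of_subset {c p q : ℕ} (hF : F ∈ uniform n k) (hk : 3 ≤ k)
    (hc : c = 1 ∨ c = 2) (hp : k ≤ p) (hpq : p < q) : F = pairSet k c p q ↔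
      c ∈ F ∧ Icc 3 (k - 1) ⊆ F ∧ p ∈ F ∧ q ∈ F := by
  constructor
  · rintro rfl
    simp only [pairSet, mem_insert, mem_Icc, true_or, or_true, and_true, true_and]
    exact fun x hx => mem_insert_of_mem (mem_insert_of_mem (mem_insert_of_mem hx))
  · rintro ⟨h2, h3, h4, h5⟩
    refine eq_of_subset_of_mem_uniform hF (insert_subset h2 (insert_subset h4
      (insert_subset h5 h3))) ?_
    rw [pairSet, card_insert_of_notMem, card_insert_of_notMem, card_insert_of_notMem,
      Nat.card_Icc]
    · omega
    all_goals simp only [mem_insert, mem_Icc]; omega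

lemma eq_pairSet_iff {c p q : ℕ} (hF : F ∈ uniform n k) (hk : 3 ≤ k) (hc : c = 1 ∨ c = 2)
    (hp : k ≤ p) (hpq : p < q) : F = pairSet k c p q ↔
      3 - c ∉ F ∧ c ∈ F ∧ Icc 3 (k - 1) ⊆ F ∧ p ∈ F ∧ q ∈ F := by
  refine ⟨fun h => ⟨?_, (eq_pairSet_iff_of_subset hF hk hc hp hpq).1 h⟩,
    fun h => (eq_pairSet_iff_of_subset hF hk hc hp hpq).2 h.2⟩
  rw [h]
  simp only [pairSet, mem_insert, mem_Icc]
  omega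

lemma pairSet_mem_uniform {c p q : ℕ} (hk : 3 ≤ k) (hc : c = 1 ∨ c = 2)
    (hp : k ≤ p) (hpq : p < q) (hq : q ≤ n) : pairSet k c p q ∈ uniform n k := by
  rw [mem_uniform]
  constructor
  · intro x
    simp only [pairSet, mem_insert, mem_Icc]
    omega
  · rw [pairSet, card_insert_of_notMem, card_insert_of_notMem, card_insert_of_notMem,
      Nat.card_Icc]
    · omega
    all_goals simp only [mem_insert, mem_Icc]; omega

/-- Membership in the listed sets, in terms of the elements contained. -/
lemma eq_pairSet_iff' {c p q : ℕ} (hk : 3 ≤ k) (hc : c = 1 ∨ c = 2)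
    (hp : k ≤ p) (hpq : p < q) (hq : q ≤ n) : F = pairSet k c p q ↔ F ∈ uniform n k ∧
      3 - c ∉ F ∧ c ∈ F ∧ Icc 3 (k - 1) ⊆ F ∧ p ∈ F ∧ q ∈ F := by
  constructor
  · intro h
    have hF : F ∈ uniform n k := h ▸ pairSet_mem_uniform hk hc hp hpq hq
    exact ⟨hF, (eq_pairSet_iff hF hk hc hp hpq).1 h⟩
  · rintro ⟨hF, h⟩
    exact (eq_pairSet_iff hF hk hc hp hpq).2 h

lemma mem_S₂_iff (hk : 6 ≤ k) (hn : k + 3 ≤ n) : F ∈ S₂ n k ↔ F ∈ uniform n k ∧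
    IsOfType (Icc 1 2) (Icc 3 (k - 1)) (Icc k (k + 3)) (ES₂ k) F := by
  have e1 : Icc 2 (k + 1) = pairSet k 2 k (k + 1) := by
    ext x; simp only [pairSet, mem_insert, mem_Icc]; omega
  have e2 : Icc 2 (k - 1) ∪ {k + 2, k + 3} = pairSet k 2 (k + 2) (k + 3) := by
    ext x; simp only [pairSet, mem_union, mem_insert, mem_singleton, mem_Icc]; omega
  have e3 : Icc 2 k ∪ {k + 3} = pairSet k 2 k (k + 3) := by
    ext x; simp only [pairSet, mem_union, mem_insert, mem_singleton, mem_Icc]; omega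
  have e4 : Icc 2 (k + 2) \ {k} = pairSet k 2 (k + 1) (k + 2) := by
    ext x; simp only [pairSet, mem_sdiff, mem_insert, mem_singleton, mem_Icc]; omega
  have e5 : Icc 3 k ∪ {1, k + 2} = pairSet k 1 k (k + 2) := by
    ext x; simp only [pairSet, mem_union, mem_insert, mem_singleton, mem_Icc]; omega
  have e6 : Icc 3 (k - 1) ∪ {1, k + 1, k + 3} = pairSet k 1 (k + 1) (k + 3) := by
    ext x; simp only [pairSet, mem_union, mem_insert, mem_singleton, mem_Icc]; omega
  simp only [S₂, e1, e2, e3, e4, e5, e6, mem_union, mem_insert, mem_singleton, mem_filter]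
  rw [eq_pairSet_iff' (n := n), eq_pairSet_iff' (n := n), eq_pairSet_iff' (n := n),
    eq_pairSet_iff' (n := n), eq_pairSet_iff' (n := n), eq_pairSet_iff' (n := n),
    isOfType_two_iff]
  · by_cases hF : F ∈ uniform n k
    · simp [ES₂, hF, and_or_left, or_assoc]
    · simp only [hF, false_and, or_false]
  all_goals omega

lemma mem_S₃_iff (hk : 6 ≤ k) (hn : k + 3 ≤ n) : F ∈ S₃ n k ↔ F ∈ uniform n k ∧
    IsOfType (Icc 1 2) (Icc 3 (k - 1)) (Icc k (k + 3)) (ES₃ k) F := by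
  have e1 : Icc 2 k ∪ {k + 2} = pairSet k 2 k (k + 2) := by
    ext x; simp only [pairSet, mem_union, mem_insert, mem_singleton, mem_Icc]; omega
  have e2 : Icc 2 (k + 2) \ {k} = pairSet k 2 (k + 1) (k + 2) := by
    ext x; simp only [pairSet, mem_sdiff, mem_insert, mem_singleton, mem_Icc]; omega
  have e3 : Icc 2 (k - 1) ∪ {k + 1, k + 3} = pairSet k 2 (k + 1) (k + 3) := by
    ext x; simp only [pairSet, mem_union, mem_insert, mem_singleton, mem_Icc]; omega
  have e4 : Icc 3 (k + 1) ∪ {1} = pairSet k 1 k (k + 1) := by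
    ext x; simp only [pairSet, mem_union, mem_insert, mem_singleton, mem_Icc]; omega
  have e5 : Icc 3 (k - 1) ∪ {1, k + 1, k + 2} = pairSet k 1 (k + 1) (k + 2) := by
    ext x; simp only [pairSet, mem_union, mem_insert, mem_singleton, mem_Icc]; omega
  have e6 : Icc 3 (k - 1) ∪ {1, k + 2, k + 3} = pairSet k 1 (k + 2) (k + 3) := by
    ext x; simp only [pairSet, mem_union, mem_insert, mem_singleton, mem_Icc]; omega
  simp only [S₃, e1, e2, e3, e4, e5, e6, mem_union, mem_insert, mem_singleton, mem_filter]
  rw [eq_pairSet_iff' (n := n), eq_pairSet_iff' (n := n), eq_pairSet_iff' (n := n),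
    eq_pairSet_iff' (n := n), eq_pairSet_iff' (n := n), eq_pairSet_iff' (n := n),
    isOfType_two_iff]
  · by_cases hF : F ∈ uniform n k
    · simp [ES₃, hF, and_or_left, or_assoc]
    · simp only [hF, false_and, or_false]
  all_goals omega

lemma mem_S₁_iff (hk : 5 ≤ k) (hn : k + 2 ≤ n) : F ∈ S₁ n k ↔ F ∈ uniform n k ∧
    IsOfType (Icc 1 2) (Icc 3 (k - 1)) (Icc k (k + 2)) (ES₁ k) F := by
  have e1 : Icc 2 (k + 2) \ {k} = pairSet k 2 (k + 1) (k + 2) := by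
    ext x; simp only [pairSet, mem_sdiff, mem_insert, mem_singleton, mem_Icc]; omega
  have e2 : Icc 1 (k + 1) \ {2} = pairSet k 1 k (k + 1) := by
    ext x; simp only [pairSet, mem_sdiff, mem_insert, mem_singleton, mem_Icc]; omega
  have e3 : Icc 1 (k + 2) \ {2, k + 1} = pairSet k 1 k (k + 2) := by
    ext x; simp only [pairSet, mem_sdiff, mem_insert, mem_singleton, mem_Icc]; omega
  have e4 : (∃ i ∈ Icc (k + 1) n, Icc 2 k ∪ {i} = F) ↔
      F ∈ uniform n k ∧ 1 ∉ F ∧ 2 ∈ F ∧ Icc 3 (k - 1) ⊆ F ∧ k ∈ F := by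
    have e5 : ∀ i, Icc 2 k ∪ {i} = pairSet k 2 k i := by
      intro i
      ext x; simp only [pairSet, mem_union, mem_insert, mem_singleton, mem_Icc]; omega
    constructor
    · rintro ⟨i, hi, hiF⟩
      rw [mem_Icc] at hi
      rw [e5, eq_comm, eq_pairSet_iff' (n := n) (by omega) (by omega) le_rfl hi.1 hi.2] at hiF
      tauto
    · rintro ⟨hF, h1, h2, h3, h4⟩
      obtain ⟨i, hiF, hi, hFi⟩ := exists_eq_union_singleton (T := Icc 2 k) hF (by
        intro x hx
        rw [mem_Icc] at hx
        obtain rfl | rfl | hx' : x = 2 ∨ x = k ∨ (3 ≤ x ∧ x ≤ k - 1) := by omega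
        · exact h2
        · exact h4
        · exact h3 (mem_Icc.2 hx')) (by rw [Nat.card_Icc]; omega)
      refine ⟨i, ?_, hFi.symm⟩
      have hin := (mem_uniform.1 hF).1 hiF
      have hi1 : i ≠ 1 := fun h => h1 (h ▸ hiF)
      rw [mem_Icc] at *
      omega
  simp only [S₁, e1, e2, e3, e4, mem_union, mem_insert, mem_singleton, mem_filter, mem_image]
  rw [eq_pairSet_iff' (n := n), eq_pairSet_iff' (n := n), eq_pairSet_iff' (n := n),
    isOfType_two_iff]
  · by_cases hF : F ∈ uniform n k
    · simp [ES₁, hF, and_or_left, or_assoc]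
    · simp only [hF, false_and, or_false]
  all_goals omega

lemma card_three_inter_eq_two (hF : F ∈ uniform n k) (hk : 3 ≤ k) {i : ℕ} (hi : i = 1 ∨ i = 2) :
    ({i} ∪ Icc 3 (k - 1) ⊆ F ∧ #(Icc k (k + 2) ∩ F) = 2) ↔
      (3 - i ∉ F ∧ i ∈ F ∧ Icc 3 (k - 1) ⊆ F ∧ ES k i F) := by
  have hI : #(Icc k (k + 2) ∩ F) =
      (if k ∈ F then 1 else 0) + (if k + 1 ∈ F then 1 else 0) + (if k + 2 ∈ F then 1 else 0) := by
    have : Icc k (k + 2) = {k, k + 1, k + 2} := by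
      ext x; simp only [mem_insert, mem_singleton, mem_Icc]; omega
    rw [← filter_mem_eq_inter, card_filter, this, sum_insert (by simp), sum_insert (by simp),
      sum_singleton, add_assoc]
  rw [union_subset_iff, singleton_subset_iff]
  constructor
  · rintro ⟨⟨h1, h2⟩, h3⟩
    have hE : ES k i F := by
      rw [hI] at h3
      rw [ES]
      split_ifs at h3 <;> simp_all
    refine ⟨?_, h1, h2, hE⟩
    rcases hE with h | h | h
    · exact ((eq_pairSet_iff (c := i) hF hk hi le_rfl (by omega)).1
        ((eq_pairSet_iff_of_subset hF hk hi le_rfl (by omega)).2 ⟨h1, h2, h⟩)).1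
    · exact ((eq_pairSet_iff (c := i) hF hk hi le_rfl (by omega)).1
        ((eq_pairSet_iff_of_subset hF hk hi le_rfl (by omega)).2 ⟨h1, h2, h⟩)).1
    · exact ((eq_pairSet_iff (c := i) hF hk hi (by omega) (by omega)).1
        ((eq_pairSet_iff_of_subset hF hk hi (by omega) (by omega)).2 ⟨h1, h2, h⟩)).1
  · rintro ⟨h0, h1, h2, hE⟩
    refine ⟨⟨h1, h2⟩, ?_⟩
    have h3 : ¬ (k ∈ F ∧ k + 1 ∈ F ∧ k + 2 ∈ F) := by
      rintro ⟨a1, a2, a3⟩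
      have e := (eq_pairSet_iff hF hk hi le_rfl (by omega)).2 ⟨h0, h1, h2, a1, a2⟩
      rw [e] at a3
      simp only [pairSet, mem_insert, mem_Icc] at a3
      omega
    rw [hI]
    rw [ES] at hE
    split_ifs <;> simp_all

lemma mem_S_iff (hk : 5 ≤ k) : F ∈ S n k ↔ F ∈ uniform n k ∧
    IsOfType (Icc 1 2) (Icc 3 (k - 1)) (Icc k (k + 2)) (ES k) F := by
  have h3 : ∀ x, x ∈ Icc 1 2 ↔ x = 1 ∨ x = 2 := fun x => by rw [mem_Icc]; omega
  rw [isOfType_two_iff]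
  simp only [S, mem_union, mem_filter, mem_biUnion, h3, exists_eq_or_imp, exists_eq_left]
  by_cases hF : F ∈ uniform n k
  · rw [card_three_inter_eq_two hF (by omega) (by omega),
      card_three_inter_eq_two hF (by omega) (by omega)]
    simp only [hF, true_and, Nat.reduceSub, or_assoc]
    exact or_congr_right (or_congr_right or_comm)
  · simp only [hF, false_and, or_false]

end Families

/-! ### Cross-intersecting graphs -/

section Graphs

/-- The element `u` is isolated by the graphs `R x`, `x ∈ X`, if some choice of one edge from each
of them has no common element other than `u`. -/
def IsIsolated (X : Finset ℕ) (R : ℕ → Set (Finset ℕ)) (u : ℕ) : Prop :=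
  ∃ f : ℕ → Finset ℕ, (∀ x ∈ X, f x ∈ R x) ∧ ∀ v, (∀ x ∈ X, v ∈ f x) → v = u

/-- Graphs as they occur in `G(k,d)`: all but one consist of the edge `ab` only, every edge of the
remaining one meets `ab`, and `a` and `b` are isolated. -/
def GraphG (X : Finset ℕ) (R : ℕ → Set (Finset ℕ)) : Prop :=
  ∃ x₀ ∈ X, ∃ a b, a ≠ b ∧ (∀ x ∈ X, x ≠ x₀ → ∀ r ∈ R x, a ∈ r ∧ b ∈ r) ∧
    (∀ r ∈ R x₀, a ∈ r ∨ b ∈ r) ∧ IsIsolated X R a ∧ IsIsolated X R b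

variable {X : Finset ℕ} {R : ℕ → Set (Finset ℕ)}

lemma exists_eq_pair {r : Finset ℕ} (hr : #r = 2) {a : ℕ} (ha : a ∈ r) :
    ∃ b, a ≠ b ∧ r = {a, b} := by
  obtain ⟨x, y, hxy, rfl⟩ := card_eq_two.1 hr
  rw [mem_insert, mem_singleton] at ha
  rcases ha with rfl | rfl
  · exact ⟨y, hxy, rfl⟩
  · exact ⟨x, hxy.symm, pair_comm _ _⟩

/-- The edges `ab` and `ac` of two of the graphs force `a` into all edges of the other graphs. If
some edge of the first graph avoids `a`, then it passes through `c`, and all graphs but the first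
consist of `ac` only. -/
lemma graphG_of_notMem (hne : ∀ x ∈ X, (R x).Nonempty) (h2 : ∀ x ∈ X, ∀ r ∈ R x, #r = 2)
    (hcross : ∀ x ∈ X, ∀ y ∈ X, ∀ z ∈ X, x ≠ y → x ≠ z → y ≠ z → ∀ r ∈ R x, ∀ s ∈ R y,
      ∀ t ∈ R z, ∃ v, v ∈ r ∧ v ∈ s ∧ v ∈ t)
    {x y z a b c : ℕ} (hx : x ∈ X) (hy : y ∈ X) (hz : z ∈ X) (hxy : x ≠ y) (hxz : x ≠ z)
    (hyz : y ≠ z) (hbc : b ≠ c) (hac : a ≠ c) (hr : {a, b} ∈ R x) (hs : {a, c} ∈ R y)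
    (hoth : ∀ w ∈ X, w ≠ x → w ≠ y → ∀ t ∈ R w, a ∈ t) {r : Finset ℕ} (hrx : r ∈ R x)
    (har : a ∉ r) : GraphG X R := by
  have h1 : ∀ w ∈ X, w ≠ x → w ≠ y → ∀ t ∈ R w, a ∈ t ∧ c ∈ t ∧ c ∈ r := by
    intro w hw hwx hwy t ht
    obtain ⟨v, hv, hv', hv''⟩ := hcross x hx y hy w hw hxy hwx.symm hwy.symm r hrx _ hs t ht
    rw [mem_insert, mem_singleton] at hv'
    rcases hv' with rfl | rfl
    · exact absurd hv har
    · exact ⟨hoth w hw hwx hwy t ht, hv'', hv⟩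
  obtain ⟨t, ht⟩ := hne z hz
  obtain ⟨hat, hct, hcr⟩ := h1 z hz hxz.symm hyz.symm t ht
  have htv : ∀ v ∈ t, v = a ∨ v = c := by
    obtain ⟨e, -, rfl⟩ := exists_eq_pair (h2 z hz t ht) hat
    rw [mem_insert, mem_singleton] at hct
    obtain rfl := hct.resolve_left hac.symm
    simp
  have h3 : ∀ s ∈ R y, a ∈ s ∧ c ∈ s := by
    intro s hs'
    constructor
    · obtain ⟨v, hv, hv', hv''⟩ := hcross x hx y hy z hz hxy hxz hyz _ hr s hs' t ht
      rw [mem_insert, mem_singleton] at hv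
      have := htv v hv''
      have : v = a := by omega
      exact this ▸ hv'
    · obtain ⟨v, hv, hv', hv''⟩ := hcross x hx y hy z hz hxy hxz hyz r hrx s hs' t ht
      rcases htv v hv'' with rfl | rfl
      · exact absurd hv har
      · exact hv'
  have h4 : ∀ w ∈ X, w ≠ x → ∀ t ∈ R w, a ∈ t ∧ c ∈ t := by
    intro w hw hwx t ht
    by_cases hwy : w = y
    · subst hwy
      exact h3 t ht
    · have := h1 w hw hwx hwy t ht
      exact ⟨this.1, this.2.1⟩
  have hex : ∀ w, ∃ t, w ∈ X → t ∈ R w := by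
    intro w
    by_cases hw : w ∈ X
    · obtain ⟨t, ht⟩ := hne w hw
      exact ⟨t, fun _ => ht⟩
    · exact ⟨∅, fun h => absurd h hw⟩
  choose g hg using hex
  have hiso : ∀ q ∈ R x, ∀ u, (∀ v, v ∈ q → (v = a ∨ v = c) → v = u) → IsIsolated X R u := by
    intro q hq u hu
    refine ⟨fun w => if w = x then q else if w = z then t else g w, fun w hw => ?_, fun v hv => ?_⟩
    · dsimp only
      split_ifs with h h'
      · exact h ▸ hq
      · exact h' ▸ ht
      · exact hg w hw
    · have e1 := hv x hx
      have e2 := hv z hz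
      simp only [if_true, if_neg hxz.symm] at e1 e2
      exact hu v e1 (htv v e2)
  refine ⟨x, hx, a, c, hac, h4, fun q hq => ?_, hiso _ hr a ?_, hiso r hrx c ?_⟩
  · obtain ⟨v, hv, -, hv''⟩ := hcross x hx y hy z hz hxy hxz hyz q hq _ hs t ht
    rcases htv v hv'' with rfl | rfl
    · exact Or.inl hv
    · exact Or.inr hv
  · intro v hv hv'
    rw [mem_insert, mem_singleton] at hv
    omega
  · rintro v hv (rfl | rfl)
    · exact absurd hv har
    · rfl

/-- At least three cross-intersecting graphs without a common vertex are those of `G(k,d)`. -/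
lemma graphG_of_three_le (hX : 3 ≤ #X) (hne : ∀ x ∈ X, (R x).Nonempty)
    (h2 : ∀ x ∈ X, ∀ r ∈ R x, #r = 2)
    (hcross : ∀ f : ℕ → Finset ℕ, (∀ x ∈ X, f x ∈ R x) → ∃ v, ∀ x ∈ X, v ∈ f x)
    (hno : ∀ v, ∃ x ∈ X, ∃ r ∈ R x, v ∉ r) : GraphG X R := by
  have hex : ∀ w, ∃ t, w ∈ X → t ∈ R w := by
    intro w
    by_cases hw : w ∈ X
    · obtain ⟨t, ht⟩ := hne w hw
      exact ⟨t, fun _ => ht⟩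
    · exact ⟨∅, fun h => absurd h hw⟩
  choose g hg using hex
  have hcross3 : ∀ x ∈ X, ∀ y ∈ X, ∀ z ∈ X, x ≠ y → x ≠ z → y ≠ z → ∀ r ∈ R x, ∀ s ∈ R y,
      ∀ t ∈ R z, ∃ v, v ∈ r ∧ v ∈ s ∧ v ∈ t := by
    intro x hx y hy z hz hxy hxz hyz r hr s hs t ht
    obtain ⟨v, hv⟩ := hcross
      (fun w => if w = x then r else if w = y then s else if w = z then t else g w) (by
        intro w hw
        split_ifs with h h' h''
        · exact h ▸ hr
        · exact h' ▸ hs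
        · exact h'' ▸ ht
        · exact hg w hw)
    have e1 := hv x hx
    have e2 := hv y hy
    have e3 := hv z hz
    simp only [if_true, if_neg hxy.symm, if_neg hxz.symm, if_neg hyz.symm] at e1 e2 e3
    exact ⟨v, e1, e2, e3⟩
  have hthird : ∀ x y, ∃ z ∈ X, x ≠ z ∧ y ≠ z := by
    intro x y
    obtain ⟨z, hz, hz'⟩ := exists_mem_notMem_of_card_lt_card
      (show #({x, y} : Finset ℕ) < #X from card_le_two.trans_lt hX)
    rw [mem_insert, mem_singleton] at hz'
    exact ⟨z, hz, fun h => hz' (Or.inl h.symm), fun h => hz' (Or.inr h.symm)⟩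
  have hdiff : ∃ x ∈ X, ∃ y ∈ X, x ≠ y ∧ ∃ r ∈ R x, ∃ s ∈ R y, r ≠ s := by
    by_contra! hc
    obtain ⟨x, hx⟩ := card_pos.1 (show 0 < #X by omega)
    obtain ⟨r, hr⟩ := hne x hx
    obtain ⟨v, hv⟩ := card_pos.1 (show 0 < #r by rw [h2 x hx r hr]; omega)
    obtain ⟨w, hw, s, hs, hvs⟩ := hno v
    by_cases hxw : x = w
    · subst hxw
      obtain ⟨z, hz, hxz, -⟩ := hthird x x
      obtain ⟨t, ht⟩ := hne z hz
      rw [hc x hx z hz hxz s hs t ht, ← hc x hx z hz hxz r hr t ht] at hvs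
      exact hvs hv
    · exact hvs (hc x hx w hw hxw r hr s hs ▸ hv)
  obtain ⟨x, hx, y, hy, hxy, r, hr, s, hs, hrs⟩ := hdiff
  obtain ⟨z, hz, hxz, hyz⟩ := hthird x y
  obtain ⟨t, ht⟩ := hne z hz
  obtain ⟨a, har, has, -⟩ := hcross3 x hx y hy z hz hxy hxz hyz r hr s hs t ht
  obtain ⟨b, hab, rfl⟩ := exists_eq_pair (h2 x hx r hr) har
  obtain ⟨c, hac, rfl⟩ := exists_eq_pair (h2 y hy s hs) has
  have hbc : b ≠ c := fun h => hrs (h ▸ rfl)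
  have hoth : ∀ w ∈ X, w ≠ x → w ≠ y → ∀ t ∈ R w, a ∈ t := by
    intro w hw hwx hwy t ht
    obtain ⟨v, hv, hv', hv''⟩ := hcross3 x hx y hy w hw hxy hwx.symm hwy.symm _ hr _ hs t ht
    rw [mem_insert, mem_singleton] at hv hv'
    have : v = a := by omega
    exact this ▸ hv''
  obtain ⟨w, hw, q, hq, haq⟩ := hno a
  by_cases hwx : w = x
  · subst hwx
    exact graphG_of_notMem hne h2 hcross3 hw hy hz hxy hxz hyz hbc hac hr hs hoth hq haq
  by_cases hwy : w = y
  · subst hwy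
    exact graphG_of_notMem hne h2 hcross3 hw hx hz hxy.symm hyz hxz hbc.symm hab hs hr
      (fun u hu h1 h2 => hoth u hu h2 h1) hq haq
  · exact absurd (hoth w hw hwx hwy q hq) haq

/-- The element `u` is the only common element of some edge of `P` and some edge of `Q`. -/
def IsIsolated₂ (P Q : Set (Finset ℕ)) (u : ℕ) : Prop :=
  ∃ p ∈ P, ∃ q ∈ Q, ∀ v ∈ p, v ∈ q → v = u

/-- The pair of graphs in `G(k,3)`. In this and the following definitions, the vertices listed at
the end are required to be isolated, so that members containing the core and missing `Y` contain
them. -/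
def PairG (P Q : Set (Finset ℕ)) : Prop :=
  ∃ a b, a ≠ b ∧ (∀ q ∈ Q, a ∈ q ∧ b ∈ q) ∧ (∀ p ∈ P, a ∈ p ∨ b ∈ p) ∧
    IsIsolated₂ P Q a ∧ IsIsolated₂ P Q b

/-- The pair of graphs in `S(k,3)`: two subgraphs of a triangle `abc`. -/
def PairS (P Q : Set (Finset ℕ)) : Prop :=
  ∃ a b c, [a, b, c].Nodup ∧
    (∀ r, r ∈ P ∨ r ∈ Q → (a ∈ r ∧ b ∈ r) ∨ (a ∈ r ∧ c ∈ r) ∨ (b ∈ r ∧ c ∈ r)) ∧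
    IsIsolated₂ P Q a ∧ IsIsolated₂ P Q b ∧ IsIsolated₂ P Q c

/-- The pair of graphs in `S₁(k,3)`: a star with centre `a` together with `bc`, and the path
`ab`, `ac`. -/
def PairS₁ (P Q : Set (Finset ℕ)) : Prop :=
  ∃ a b c, [a, b, c].Nodup ∧ (∀ p ∈ P, a ∈ p ∨ (b ∈ p ∧ c ∈ p)) ∧
    (∀ q ∈ Q, a ∈ q ∧ (b ∈ q ∨ c ∈ q)) ∧
    IsIsolated₂ P Q a ∧ IsIsolated₂ P Q b ∧ IsIsolated₂ P Q c

/-- The pair of graphs in `S₂(k,3)`: the cycle `abce` and its diagonals. -/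
def PairS₂ (P Q : Set (Finset ℕ)) : Prop :=
  ∃ a b c e, [a, b, c, e].Nodup ∧ (∀ p ∈ P, (a ∈ p ∧ b ∈ p) ∨ (c ∈ p ∧ e ∈ p) ∨
      (a ∈ p ∧ e ∈ p) ∨ (b ∈ p ∧ c ∈ p)) ∧
    (∀ q ∈ Q, (a ∈ q ∧ c ∈ q) ∨ (b ∈ q ∧ e ∈ q)) ∧
    IsIsolated₂ P Q a ∧ IsIsolated₂ P Q b ∧ IsIsolated₂ P Q c ∧ IsIsolated₂ P Q e

/-- The pair of graphs in `S₃(k,3)`: the paths `acbe` and `abce`. -/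
def PairS₃ (P Q : Set (Finset ℕ)) : Prop :=
  ∃ a b c e, [a, b, c, e].Nodup ∧
    (∀ p ∈ P, (a ∈ p ∧ c ∈ p) ∨ (b ∈ p ∧ c ∈ p) ∨ (b ∈ p ∧ e ∈ p)) ∧
    (∀ q ∈ Q, (a ∈ q ∧ b ∈ q) ∨ (b ∈ q ∧ c ∈ q) ∨ (c ∈ q ∧ e ∈ q)) ∧
    IsIsolated₂ P Q a ∧ IsIsolated₂ P Q b ∧ IsIsolated₂ P Q c ∧ IsIsolated₂ P Q e

/-- Pairs of graphs of one of the five kinds. -/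
def PairListed (P Q : Set (Finset ℕ)) : Prop :=
  PairG P Q ∨ PairS P Q ∨ PairS₁ P Q ∨ PairS₂ P Q ∨ PairS₃ P Q

variable {P Q : Set (Finset ℕ)}

lemma pair_iff {r : Finset ℕ} (hr : #r = 2) : ∃ x y, x ≠ y ∧ ∀ v, v ∈ r ↔ v = x ∨ v = y := by
  obtain ⟨x, y, hxy, rfl⟩ := card_eq_two.1 hr
  exact ⟨x, y, hxy, by simp⟩

lemma isIsolated₂_of_pair {u v w : ℕ} (hp : {u, v} ∈ P) (hq : {u, w} ∈ Q) (hvw : v ≠ w) :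
    IsIsolated₂ P Q u := by
  refine ⟨_, hp, _, hq, fun x hx hx' => ?_⟩
  rw [mem_insert, mem_singleton] at hx hx'
  omega

lemma pairG_of_subsingleton (hQ : ∀ q ∈ Q, #q = 2)
    (hcross : ∀ p ∈ P, ∀ q ∈ Q, ∃ v ∈ p, v ∈ q) (hno : ∀ v, ∃ r, (r ∈ P ∨ r ∈ Q) ∧ v ∉ r)
    {q : Finset ℕ} (hq : q ∈ Q) (hs : ∀ q' ∈ Q, q' = q) : PairG P Q := by
  obtain ⟨a, b, hab, hqab⟩ := pair_iff (hQ q hq)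
  have hmiss : ∀ v ∈ q, ∃ p ∈ P, v ∉ p := by
    intro v hv
    obtain ⟨r, hr | hr, hvr⟩ := hno v
    · exact ⟨r, hr, hvr⟩
    · exact absurd (hs r hr ▸ hv) hvr
  refine ⟨a, b, hab, fun q' hq' => ?_, fun p hp => ?_, ?_, ?_⟩
  · rw [hs q' hq', hqab, hqab]
    simp
  · obtain ⟨v, hv, hv'⟩ := hcross p hp q hq
    rcases (hqab v).1 hv' with rfl | rfl
    · exact Or.inl hv
    · exact Or.inr hv
  · obtain ⟨p, hp, hbp⟩ := hmiss b ((hqab b).2 (Or.inr rfl))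
    refine ⟨p, hp, q, hq, fun v hv hvq => ((hqab v).1 hvq).resolve_right ?_⟩
    rintro rfl
    exact hbp hv
  · obtain ⟨p, hp, hap⟩ := hmiss a ((hqab a).2 (Or.inl rfl))
    refine ⟨p, hp, q, hq, fun v hv hvq => ((hqab v).1 hvq).resolve_left ?_⟩
    rintro rfl
    exact hap hv

lemma eq_pair_of_mem {p : Finset ℕ} (hp : #p = 2) {a b : ℕ} (hab : a ≠ b) (ha : a ∈ p)
    (hb : b ∈ p) : p = {a, b} :=
  (eq_of_subset_of_card_le (insert_subset ha (singleton_subset_iff.2 hb))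
    (by rw [hp, card_pair hab])).symm

lemma mem_or_mem_of_cross (hcross : ∀ p ∈ P, ∀ q ∈ Q, ∃ v ∈ p, v ∈ q) {p : Finset ℕ}
    (hp : p ∈ P) {a b : ℕ} (h : {a, b} ∈ Q) : a ∈ p ∨ b ∈ p := by
  obtain ⟨v, hv, hv'⟩ := hcross p hp _ h
  rw [mem_insert, mem_singleton] at hv'
  rcases hv' with rfl | rfl
  · exact Or.inl hv
  · exact Or.inr hv

lemma ne_of_nodup_four {a b c e : ℕ} (hd : [a, b, c, e].Nodup) :
    a ≠ b ∧ a ≠ c ∧ a ≠ e ∧ b ≠ c ∧ b ≠ e ∧ c ≠ e := by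
  simp only [List.nodup_cons, List.mem_cons, List.not_mem_nil, or_false, not_or,
    not_false_eq_true, List.nodup_nil, and_true] at hd
  tauto

lemma not_three_mem {p : Finset ℕ} (hp : #p = 2) {a b c : ℕ} (hab : a ≠ b) (hac : a ≠ c)
    (hbc : b ≠ c) : ¬ (a ∈ p ∧ b ∈ p ∧ c ∈ p) := by
  rintro ⟨ha, hb, hc⟩
  rw [eq_pair_of_mem hp hab ha hb, mem_insert, mem_singleton] at hc
  omega

lemma IsIsolated₂.symm {u : ℕ} : IsIsolated₂ P Q u → IsIsolated₂ Q P u :=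
  fun ⟨p, hp, q, hq, h⟩ => ⟨q, hq, p, hp, fun v hv hv' => h v hv' hv⟩

/-- Both graphs contain two disjoint edges. -/
lemma pairListed_of_disjoint_disjoint (hP : ∀ p ∈ P, #p = 2) (hQ : ∀ q ∈ Q, #q = 2)
    (hcross : ∀ p ∈ P, ∀ q ∈ Q, ∃ v ∈ p, v ∈ q) (hcross' : ∀ q ∈ Q, ∀ p ∈ P, ∃ v ∈ q, v ∈ p)
    {a b c e : ℕ} (hd : [a, b, c, e].Nodup)
    (h1 : {a, b} ∈ P) (h2 : {c, e} ∈ P) (h3 : {a, c} ∈ Q) (h4 : {b, e} ∈ Q) :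
    PairListed P Q ∨ PairListed Q P := by
  obtain ⟨hab, hac, hae, hbc, hbe, hce⟩ := ne_of_nodup_four hd
  have hPc : ∀ p ∈ P, (a ∈ p ∧ b ∈ p) ∨ (c ∈ p ∧ e ∈ p) ∨ (a ∈ p ∧ e ∈ p) ∨ (b ∈ p ∧ c ∈ p) := by
    intro p hp
    have := mem_or_mem_of_cross hcross hp h3
    have := mem_or_mem_of_cross hcross hp h4
    tauto
  have hQc : ∀ q ∈ Q, (a ∈ q ∧ c ∈ q) ∨ (b ∈ q ∧ e ∈ q) ∨ (a ∈ q ∧ e ∈ q) ∨ (b ∈ q ∧ c ∈ q) := by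
    intro q hq
    have := mem_or_mem_of_cross hcross' hq h1
    have := mem_or_mem_of_cross hcross' hq h2
    tauto
  have ia : IsIsolated₂ P Q a := isIsolated₂_of_pair h1 h3 hbc
  have ib : IsIsolated₂ P Q b := isIsolated₂_of_pair (pair_comm a b ▸ h1) h4 hae
  have ic : IsIsolated₂ P Q c := isIsolated₂_of_pair h2 (pair_comm a c ▸ h3) hae.symm
  have ie : IsIsolated₂ P Q e :=
    isIsolated₂_of_pair (pair_comm c e ▸ h2) (pair_comm b e ▸ h4) hbc.symm
  by_cases hQ' : ∀ q ∈ Q, (a ∈ q ∧ c ∈ q) ∨ (b ∈ q ∧ e ∈ q)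
  · exact Or.inl (Or.inr (Or.inr (Or.inr (Or.inl ⟨a, b, c, e, hd, hPc, hQ', ia, ib, ic, ie⟩))))
  by_cases hP' : ∀ p ∈ P, (a ∈ p ∧ b ∈ p) ∨ (c ∈ p ∧ e ∈ p)
  · refine Or.inr (Or.inr (Or.inr (Or.inr (Or.inl ⟨a, c, b, e,
      by simp [hab, hac, hae, hbc.symm, hbe, hce], fun q hq => ?_, hP', ia.symm, ic.symm, ib.symm,
      ie.symm⟩))))
    have := hQc q hq
    tauto
  push Not at hQ' hP'
  obtain ⟨q₀, hq₀, hq₁, hq₂⟩ := hQ'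
  obtain ⟨p₀, hp₀, hp₁, hp₂⟩ := hP'
  -- Some edge of each graph is `ae` or `bc`, and these edges must be the same.
  have hq₀' : q₀ = {a, e} ∨ q₀ = {b, c} := by
    rcases hQc q₀ hq₀ with h | h | h | h
    · exact absurd h.2 (hq₁ h.1)
    · exact absurd h.2 (hq₂ h.1)
    · exact Or.inl (eq_pair_of_mem (hQ _ hq₀) hae h.1 h.2)
    · exact Or.inr (eq_pair_of_mem (hQ _ hq₀) hbc h.1 h.2)
  have hp₀' : p₀ = {a, e} ∨ p₀ = {b, c} := by
    rcases hPc p₀ hp₀ with h | h | h | h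
    · exact absurd h.2 (hp₁ h.1)
    · exact absurd h.2 (hp₂ h.1)
    · exact Or.inl (eq_pair_of_mem (hP _ hp₀) hae h.1 h.2)
    · exact Or.inr (eq_pair_of_mem (hP _ hp₀) hbc h.1 h.2)
  rcases hq₀' with rfl | rfl
  · have hp₀'' : p₀ = {a, e} := by
      refine hp₀'.resolve_right ?_
      rintro rfl
      have := mem_or_mem_of_cross hcross hp₀ hq₀
      simp only [mem_insert, mem_singleton] at this
      omega
    subst hp₀''
    refine Or.inl (Or.inr (Or.inr (Or.inr (Or.inr ⟨b, e, a, c,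
      by simp [hbe, hab.symm, hbc, hae.symm, hce.symm, hac], fun p hp => ?_, fun q hq => ?_,
      ib, ie, ia, ic⟩))))
    · have h5 := hPc p hp
      have h6 := mem_or_mem_of_cross hcross hp hq₀
      have h7 := not_three_mem (hP p hp) hab hac hbc
      have h8 := not_three_mem (hP p hp) hbc hbe hce
      clear * - h5 h6 h7 h8
      tauto
    · have h5 := hQc q hq
      have h6 := mem_or_mem_of_cross hcross' hq hp₀
      have h7 := not_three_mem (hQ q hq) hab hac hbc
      have h8 := not_three_mem (hQ q hq) hbc hbe hce
      clear * - h5 h6 h7 h8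
      tauto
  · have hp₀'' : p₀ = {b, c} := by
      refine hp₀'.resolve_left ?_
      rintro rfl
      have := mem_or_mem_of_cross hcross hp₀ hq₀
      simp only [mem_insert, mem_singleton] at this
      omega
    subst hp₀''
    refine Or.inl (Or.inr (Or.inr (Or.inr (Or.inr ⟨a, c, b, e,
      by simp [hab, hac, hae, hbc.symm, hbe, hce], fun p hp => ?_, fun q hq => ?_,
      ia, ic, ib, ie⟩))))
    · have h5 := hPc p hp
      have h6 := mem_or_mem_of_cross hcross hp hq₀
      have h7 := not_three_mem (hP p hp) hab hae hbe
      have h8 := not_three_mem (hP p hp) hac hae hce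
      clear * - h5 h6 h7 h8
      tauto
    · have h5 := hQc q hq
      have h6 := mem_or_mem_of_cross hcross' hq hp₀
      have h7 := not_three_mem (hQ q hq) hab hae hbe
      have h8 := not_three_mem (hQ q hq) hac hae hce
      clear * - h5 h6 h7 h8
      tauto

/-- The first graph contains two disjoint edges, the second one contains two edges, but no
disjoint ones. -/
lemma pairS₁_of_disjoint_adjacent (hQ : ∀ q ∈ Q, #q = 2)
    (hcross : ∀ p ∈ P, ∀ q ∈ Q, ∃ v ∈ p, v ∈ q) (hcross' : ∀ q ∈ Q, ∀ p ∈ P, ∃ v ∈ q, v ∈ p)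
    (hQQ : ∀ q ∈ Q, ∀ q' ∈ Q, ∃ v ∈ q, v ∈ q')
    {a b c e : ℕ} (hd : [a, b, c, e].Nodup)
    (h1 : {a, b} ∈ P) (h2 : {c, e} ∈ P) (h3 : {a, c} ∈ Q) (h4 : {a, e} ∈ Q) : PairS₁ P Q := by
  obtain ⟨hab, hac, hae, hbc, hbe, hce⟩ := ne_of_nodup_four hd
  refine ⟨a, c, e, by simp [hac, hae, hce], fun p hp => ?_, fun q hq => ?_,
    isIsolated₂_of_pair h1 h3 hbc, isIsolated₂_of_pair h2 (pair_comm a c ▸ h3) hae.symm,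
    isIsolated₂_of_pair (pair_comm c e ▸ h2) (pair_comm a e ▸ h4) hac.symm⟩
  · have := mem_or_mem_of_cross hcross hp h3
    have := mem_or_mem_of_cross hcross hp h4
    tauto
  · have := mem_or_mem_of_cross hcross' hq h2
    have := mem_or_mem_of_cross hQQ hq h3
    have := mem_or_mem_of_cross hQQ hq h4
    have := mem_or_mem_of_cross hcross' hq h1
    have := not_three_mem (hQ q hq) hbc hbe hce
    tauto

/-- Neither graph contains two disjoint edges, and both contain at least two edges. -/
lemma pairS_of_intersecting (hP : ∀ p ∈ P, #p = 2) (hQ : ∀ q ∈ Q, #q = 2)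
    (hcross : ∀ p ∈ P, ∀ q ∈ Q, ∃ v ∈ p, v ∈ q) (hcross' : ∀ q ∈ Q, ∀ p ∈ P, ∃ v ∈ q, v ∈ p)
    (hPP : ∀ p ∈ P, ∀ p' ∈ P, ∃ v ∈ p, v ∈ p') (hQQ : ∀ q ∈ Q, ∀ q' ∈ Q, ∃ v ∈ q, v ∈ q')
    (hno : ∀ v, ∃ r, (r ∈ P ∨ r ∈ Q) ∧ v ∉ r) {p p' q q' : Finset ℕ} (hp : p ∈ P) (hp' : p' ∈ P)
    (hpp' : p ≠ p') (hq : q ∈ Q) (hq' : q' ∈ Q) (hqq' : q ≠ q') : PairS P Q := by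
  obtain ⟨a, haq, haq'⟩ := hQQ q hq q' hq'
  obtain ⟨b, hab, rfl⟩ := exists_eq_pair (hQ q hq) haq
  obtain ⟨c, hac, rfl⟩ := exists_eq_pair (hQ q' hq') haq'
  have hbc : b ≠ c := fun h => hqq' (h ▸ rfl)
  have hall : ∀ r, r ∈ P ∨ r ∈ Q → a ∈ r ∨ (b ∈ r ∧ c ∈ r) := by
    rintro r (hr | hr)
    · have := mem_or_mem_of_cross hcross hr hq
      have := mem_or_mem_of_cross hcross hr hq'
      tauto
    · have := mem_or_mem_of_cross hQQ hr hq
      have := mem_or_mem_of_cross hQQ hr hq'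
      tauto
  -- An edge avoiding `a` must be `bc`.
  obtain ⟨r, hr, har⟩ := hno a
  have hrbc : r = {b, c} := by
    have := (hall r hr).resolve_left har
    exact eq_pair_of_mem (hr.elim (hP r) (hQ r)) hbc this.1 this.2
  subst hrbc
  have hall' : ∀ s, s ∈ P ∨ s ∈ Q → (a ∈ s ∧ b ∈ s) ∨ (a ∈ s ∧ c ∈ s) ∨ (b ∈ s ∧ c ∈ s) := by
    intro s hs
    have h1 := hall s hs
    have h2 : b ∈ s ∨ c ∈ s := by
      rcases hs with hs | hs <;> rcases hr with hr | hr
      · exact mem_or_mem_of_cross hPP hs hr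
      · exact mem_or_mem_of_cross hcross hs hr
      · exact mem_or_mem_of_cross hcross' hs hr
      · exact mem_or_mem_of_cross hQQ hs hr
    tauto
  refine ⟨a, b, c, by simp [hab, hac, hbc], hall', ?_⟩
  have hPt : ∀ s ∈ P, s = {a, b} ∨ s = {a, c} ∨ s = {b, c} := by
    intro s hs
    rcases hall' s (Or.inl hs) with h | h | h
    · exact Or.inl (eq_pair_of_mem (hP s hs) hab h.1 h.2)
    · exact Or.inr (Or.inl (eq_pair_of_mem (hP s hs) hac h.1 h.2))
    · exact Or.inr (Or.inr (eq_pair_of_mem (hP s hs) hbc h.1 h.2))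
  have hab' := pair_comm a b ▸ hq
  have hac' := pair_comm a c ▸ hq'
  have two : ({a, b} ∈ P ∨ {a, c} ∈ P) ∧ ({a, b} ∈ P ∨ {b, c} ∈ P) ∧ ({a, c} ∈ P ∨ {b, c} ∈ P) := by
    rcases hPt p hp with rfl | rfl | rfl <;> rcases hPt p' hp' with rfl | rfl | rfl <;>
      simp_all
  refine ⟨?_, ?_, ?_⟩
  · rcases two.1 with h | h
    · exact isIsolated₂_of_pair h hq' hbc
    · exact isIsolated₂_of_pair h hq hbc.symm
  · have hbcP : {b, c} ∈ P → IsIsolated₂ P Q b := fun h => isIsolated₂_of_pair h hab' hac.symm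
    rcases hr with hr | hr
    · exact hbcP hr
    rcases two.2.1 with h | h
    · exact isIsolated₂_of_pair (pair_comm a b ▸ h) hr hac
    · exact hbcP h
  · have hbcP : {b, c} ∈ P → IsIsolated₂ P Q c := fun h =>
      isIsolated₂_of_pair (pair_comm b c ▸ h) hac' hab.symm
    rcases hr with hr | hr
    · exact hbcP hr
    rcases two.2.2 with h | h
    · exact isIsolated₂_of_pair (pair_comm a c ▸ h) (pair_comm b c ▸ hr) hab
    · exact hbcP h

/-- The first graph contains the disjoint edges `ab` and `ce`, the second one contains `ac` and
another edge `q`. If `q` is disjoint from `ac`, both graphs contain disjoint edges; otherwise the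
second graph is assumed to contain none. -/
lemma pairListed_of_disjoint_of_ne (hP : ∀ p ∈ P, #p = 2) (hQ : ∀ q ∈ Q, #q = 2)
    (hcross : ∀ p ∈ P, ∀ q ∈ Q, ∃ v ∈ p, v ∈ q) (hcross' : ∀ q ∈ Q, ∀ p ∈ P, ∃ v ∈ q, v ∈ p)
    {a b c e : ℕ} (hd : [a, b, c, e].Nodup) (h1 : {a, b} ∈ P) (h2 : {c, e} ∈ P)
    (h3 : {a, c} ∈ Q) {q : Finset ℕ} (hq : q ∈ Q) (hne : q ≠ {a, c})
    (hQQ : Disjoint q {a, c} ∨ ∀ q ∈ Q, ∀ q' ∈ Q, ∃ v ∈ q, v ∈ q') :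
    PairListed P Q ∨ PairListed Q P := by
  obtain ⟨hab, hac, hae, hbc, hbe, hce⟩ := ne_of_nodup_four hd
  have hq' : q = {a, e} ∨ q = {b, c} ∨ q = {b, e} := by
    have := mem_or_mem_of_cross hcross' hq h1
    have := mem_or_mem_of_cross hcross' hq h2
    by_cases ha : a ∈ q <;> by_cases hc : c ∈ q
    · exact absurd (eq_pair_of_mem (hQ q hq) hac ha hc) hne
    · exact Or.inl (eq_pair_of_mem (hQ q hq) hae ha (by tauto))
    · exact Or.inr (Or.inl (eq_pair_of_mem (hQ q hq) hbc (by tauto) hc))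
    · exact Or.inr (Or.inr (eq_pair_of_mem (hQ q hq) hbe (by tauto) (by tauto)))
  rcases hq' with rfl | rfl | rfl
  · rcases hQQ with hQQ | hQQ
    · exact absurd hQQ (by simp)
    · exact Or.inl (Or.inr (Or.inr (Or.inl
        (pairS₁_of_disjoint_adjacent hQ hcross hcross' hQQ hd h1 h2 h3 hq))))
  · rcases hQQ with hQQ | hQQ
    · exact absurd hQQ (by simp)
    · exact Or.inl (Or.inr (Or.inr (Or.inl
        (pairS₁_of_disjoint_adjacent hQ hcross hcross' hQQ (a := c) (b := e) (c := a) (e := b)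
          (by simp [hce, hac.symm, hbc.symm, hae.symm, hbe.symm, hab]) h2 h1
          (pair_comm a c ▸ h3) (pair_comm b c ▸ hq)))))
  · exact pairListed_of_disjoint_disjoint hP hQ hcross hcross' hd h1 h2 h3 hq

lemma pairListed_of_disjoint (hP : ∀ p ∈ P, #p = 2) (hQ : ∀ q ∈ Q, #q = 2)
    (hcross : ∀ p ∈ P, ∀ q ∈ Q, ∃ v ∈ p, v ∈ q) (hcross' : ∀ q ∈ Q, ∀ p ∈ P, ∃ v ∈ q, v ∈ p)
    {p p' : Finset ℕ} (hp : p ∈ P) (hp' : p' ∈ P) (hd : Disjoint p p')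
    (hQ2 : ∃ q ∈ Q, ∃ q' ∈ Q, q ≠ q') : PairListed P Q ∨ PairListed Q P := by
  have hchoice : ∃ q ∈ Q, ∃ q' ∈ Q, q' ≠ q ∧
      (Disjoint q' q ∨ ∀ q ∈ Q, ∀ q' ∈ Q, ∃ v ∈ q, v ∈ q') := by
    by_cases hQQ : ∀ q ∈ Q, ∀ q' ∈ Q, ∃ v ∈ q, v ∈ q'
    · obtain ⟨q, hq, q', hq', h⟩ := hQ2
      exact ⟨q, hq, q', hq', h.symm, Or.inr hQQ⟩
    · push Not at hQQ
      obtain ⟨q, hq, q', hq', h⟩ := hQQ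
      have hdis : Disjoint q' q := disjoint_right.2 h
      refine ⟨q, hq, q', hq', fun h' => ?_, Or.inl hdis⟩
      subst h'
      have := hQ q' hq
      rw [disjoint_self_iff_empty] at hdis
      simp [hdis] at this
  obtain ⟨q, hq, q', hq', hne, hQQ⟩ := hchoice
  obtain ⟨a, hap, haq⟩ := hcross p hp q hq
  obtain ⟨c, hcp, hcq⟩ := hcross p' hp' q hq
  have hac : a ≠ c := by
    rintro rfl
    exact disjoint_left.1 hd hap hcp
  obtain rfl := eq_pair_of_mem (hQ q hq) hac haq hcq
  obtain ⟨b, hab, rfl⟩ := exists_eq_pair (hP p hp) hap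
  obtain ⟨e, hce, rfl⟩ := exists_eq_pair (hP p' hp') hcp
  refine pairListed_of_disjoint_of_ne hP hQ hcross hcross' ?_ hp hp' hq hq' hne hQQ
  simp only [disjoint_insert_left, disjoint_singleton_left, mem_insert, mem_singleton] at hd
  simp only [List.nodup_cons, List.mem_cons, List.not_mem_nil, or_false, not_or,
    not_false_eq_true, List.nodup_nil, and_true]
  tauto

/-- Two cross-intersecting graphs without a common vertex are, up to exchanging them, of one of
the five listed kinds. -/
lemma pairListed_of_cross (hP : ∀ p ∈ P, #p = 2) (hQ : ∀ q ∈ Q, #q = 2) (hPne : P.Nonempty)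
    (hQne : Q.Nonempty) (hcross : ∀ p ∈ P, ∀ q ∈ Q, ∃ v ∈ p, v ∈ q)
    (hno : ∀ v, ∃ r, (r ∈ P ∨ r ∈ Q) ∧ v ∉ r) : PairListed P Q ∨ PairListed Q P := by
  have hcross' : ∀ q ∈ Q, ∀ p ∈ P, ∃ v ∈ q, v ∈ p := fun q hq p hp => by
    obtain ⟨v, hv, hv'⟩ := hcross p hp q hq
    exact ⟨v, hv', hv⟩
  have hno' : ∀ v, ∃ r, (r ∈ Q ∨ r ∈ P) ∧ v ∉ r := fun v => by
    obtain ⟨r, hr, hvr⟩ := hno v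
    exact ⟨r, hr.symm, hvr⟩
  by_cases hQ2 : ∃ q ∈ Q, ∃ q' ∈ Q, q ≠ q'
  swap
  · push Not at hQ2
    obtain ⟨q, hq⟩ := hQne
    exact Or.inl (Or.inl (pairG_of_subsingleton hQ hcross hno hq fun q' hq' => hQ2 q' hq' q hq))
  by_cases hP2 : ∃ p ∈ P, ∃ p' ∈ P, p ≠ p'
  swap
  · push Not at hP2
    obtain ⟨p, hp⟩ := hPne
    exact Or.inr (Or.inl (pairG_of_subsingleton hP hcross' hno' hp fun p' hp' => hP2 p' hp' p hp))
  by_cases hPP : ∀ p ∈ P, ∀ p' ∈ P, ∃ v ∈ p, v ∈ p'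
  swap
  · push Not at hPP
    obtain ⟨p, hp, p', hp', h⟩ := hPP
    exact pairListed_of_disjoint hP hQ hcross hcross' hp hp' (disjoint_left.2 h) hQ2
  by_cases hQQ : ∀ q ∈ Q, ∀ q' ∈ Q, ∃ v ∈ q, v ∈ q'
  swap
  · push Not at hQQ
    obtain ⟨q, hq, q', hq', h⟩ := hQQ
    exact (pairListed_of_disjoint hQ hP hcross' hcross hq hq' (disjoint_left.2 h) hP2).symm
  obtain ⟨q, hq, q', hq', hqq'⟩ := hQ2
  obtain ⟨p, hp, p', hp', hpp'⟩ := hP2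
  exact Or.inl (Or.inr (Or.inl
    (pairS_of_intersecting hP hQ hcross hcross' hPP hQQ hno hp hp' hpp' hq hq' hqq')))

end Graphs

/-! ### The structure of the covers of size `d` -/

section Structure
variable {n k d : ℕ} {𝓕 : Finset (Finset ℕ)}

/-- Sets of size `d` that pairwise share `d - 1` elements either contain a common set of size
`d - 1`, or lie in a common set of size `d + 1`. In the second case, every set sharing `d - 1`
elements with each of them shares `d` elements with that common set. -/
lemma sunflower_or_subset (hd : 1 ≤ d) {𝓣 : Finset (Finset ℕ)} (hT : ∀ T ∈ 𝓣, #T = d)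
    (hTT : ∀ T ∈ 𝓣, ∀ T' ∈ 𝓣, d - 1 ≤ #(T ∩ T')) (h2 : 2 ≤ #𝓣) :
    (∃ X, #X + 1 = d ∧ ∀ T ∈ 𝓣, X ⊆ T) ∨
      ∃ Z ⊆ 𝓣.biUnion id, #Z = d + 1 ∧ ∀ W, (∀ T ∈ 𝓣, d - 1 ≤ #(W ∩ T)) → d ≤ #(W ∩ Z) := by
  obtain ⟨T₁, h₁, T₂, h₂, hne⟩ := one_lt_card.1 h2
  have hX : #(T₁ ∩ T₂) + 1 = d := by
    have h3 := hTT T₁ h₁ T₂ h₂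
    have h4 : #(T₁ ∩ T₂) ≠ d := by
      intro h
      have e1 := eq_of_subset_of_card_le inter_subset_left (by rw [hT T₁ h₁, h])
      have e2 := eq_of_subset_of_card_le inter_subset_right (by rw [hT T₂ h₂, h])
      exact hne (e1.symm.trans e2)
    have h5 := card_le_card (inter_subset_left (s₁ := T₁) (s₂ := T₂))
    rw [hT T₁ h₁] at h5
    omega
  by_cases hall : ∀ T ∈ 𝓣, T₁ ∩ T₂ ⊆ T
  · exact Or.inl ⟨_, hX, hall⟩
  push Not at hall
  obtain ⟨T₃, h₃, hT₃⟩ := hall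
  -- A set with too few elements in `T₁ ∪ T₂` has the same trace on every `Tᵢ` inside the union.
  have key : ∀ W, d - 1 ≤ #(W ∩ T₁) → d - 1 ≤ #(W ∩ T₂) → #(W ∩ (T₁ ∪ T₂)) < d →
      W ∩ (T₁ ∪ T₂) = T₁ ∩ T₂ := by
    intro W hW1 hW2 hlt
    have e1 : W ∩ T₁ = W ∩ (T₁ ∪ T₂) :=
      eq_of_subset_of_card_le (inter_subset_inter_left subset_union_left) (by omega)
    have e2 : W ∩ T₂ = W ∩ (T₁ ∪ T₂) :=
      eq_of_subset_of_card_le (inter_subset_inter_left subset_union_right) (by omega)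
    refine eq_of_subset_of_card_le (subset_inter ?_ ?_) ?_
    · exact e1 ▸ inter_subset_right
    · exact e2 ▸ inter_subset_right
    · rw [← e1]
      omega
  have hT₃Z : T₃ ⊆ T₁ ∪ T₂ := by
    by_contra hsub
    refine hT₃ ((key T₃ (hTT T₃ h₃ T₁ h₁) (hTT T₃ h₃ T₂ h₂) ?_).symm.subset.trans
      inter_subset_left)
    have := card_lt_card (inter_subset_left.ssubset_of_ne (fun h => hsub (inter_eq_left.1 h)))
    rwa [hT T₃ h₃] at this
  refine Or.inr ⟨T₁ ∪ T₂, union_subset (subset_biUnion_of_mem id h₁)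
    (subset_biUnion_of_mem id h₂), ?_, fun W hW => ?_⟩
  · have := card_union_add_card_inter T₁ T₂
    rw [hT T₁ h₁, hT T₂ h₂] at this
    omega
  · by_contra! hlt
    have e := key W (hW T₁ h₁) (hW T₂ h₂) hlt
    have e3 : W ∩ T₃ = T₁ ∩ T₂ := by
      rw [← e]
      refine eq_of_subset_of_card_le (inter_subset_inter_left hT₃Z) ?_
      have := hW T₃ h₃
      omega
    exact hT₃ (e3.symm.subset.trans inter_subset_right)

lemma isIntersecting_H {l : ℕ} (hd : 2 ≤ d) (hl : 1 ≤ l) : IsIntersecting d (H n k d l) := by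
  refine isIntersecting_of_isOfType (X := Icc 1 (d - 1)) (Y := Icc d (d + l - 1)) (by
    rw [Nat.card_Icc]; omega) (nonempty_Icc.2 (by omega))
    (fun F hF => ((mem_H_iff hd hl).1 hF).2) fun f hf => ?_
  have hmem : d ∈ Icc d (d + l - 1) := mem_Icc.2 (by omega)
  exact ⟨d, hmem, fun x hx => (hf x hx).2.2.1 hmem⟩

lemma image_mem_uniform {F : Finset ℕ} (hF : F ∈ uniform n k) (π : Equiv.Perm ℕ)
    (hπ : ∀ x, π x ∈ Icc 1 n ↔ x ∈ Icc 1 n) : F.image π ∈ uniform n k := by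
  rw [mem_uniform] at hF ⊢
  exact ⟨image_subset_iff.2 fun x hx => (hπ x).2 (hF.1 hx),
    by rw [card_image_of_injective _ π.injective, hF.2]⟩

/-- A family all of whose members have `d` elements in a fixed set of size `d + 1`. -/
lemma IsMaximalNontrivial.iso_H_two (h : IsMaximalNontrivial n k d 𝓕) (hd : 2 ≤ d)
    {Z : Finset ℕ} (hZn : Z ⊆ Icc 1 n) (hZ : #Z = d + 1) (hF : ∀ F ∈ 𝓕, d ≤ #(F ∩ Z)) :
    Iso n 𝓕 (H n k d 2) := by
  obtain ⟨π, hπ, hst⟩ := exists_stacking n [Z] (by simpa using hZn) (by simp)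
  have hst' : Z.image π = Icc 1 (d + 1) := by simpa [IsStacking, hZ] using hst
  refine h.iso π hπ (fun F hF => ((mem_H_iff hd (by omega)).1 hF).1)
    (isIntersecting_H hd (by omega)) fun F hFF => ?_
  refine (mem_H_iff hd (by omega)).2 ⟨image_mem_uniform (h.subset_uniform hFF) π hπ, ?_⟩
  have hc : d ≤ #(F.image π ∩ Icc 1 (d + 1)) := by
    rw [← hst', ← image_inter _ _ π.injective, card_image_of_injective _ π.injective]
    exact hF F hFF
  generalize F.image π = F' at hc
  by_cases hsub : Icc 1 (d - 1) ⊆ F'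
  · refine Or.inl ⟨hsub, ?_⟩
    by_contra! hno
    have : F' ∩ Icc 1 (d + 1) ⊆ Icc 1 (d - 1) := by
      intro x hx
      rw [mem_inter, mem_Icc] at hx
      have := hno x
      rw [mem_Icc] at this ⊢
      by_contra hx'
      exact this (by omega) hx.1
    have := card_le_card this
    rw [Nat.card_Icc] at this
    omega
  · obtain ⟨x, hx, hxF⟩ := not_subset.1 hsub
    have hx' : x ∈ Icc 1 (d + 1) := Icc_subset_Icc_right (by omega) hx
    have e : F' ∩ Icc 1 (d + 1) = (Icc 1 (d + 1)).erase x := by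
      refine eq_of_subset_of_card_le (fun y hy => ?_) ?_
      · rw [mem_inter] at hy
        exact mem_erase.2 ⟨fun h => hxF (h ▸ hy.1), hy.2⟩
      · rw [card_erase_of_mem hx', Nat.card_Icc]
        omega
    have hsub' : (Icc 1 (d + 1)).erase x ⊆ F' := e ▸ inter_subset_left
    rw [mem_Icc] at hx
    refine Or.inr (Or.inr ⟨x, mem_Icc.2 hx, hxF, fun y hy => hsub' ?_, fun y hy => hsub' ?_,
      trivial⟩)
    · rw [mem_erase, mem_Icc] at *
      omega
    · rw [mem_erase, mem_Icc] at *
      omega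

/-- The covers of size `d` form a sunflower with core `X` of size `d - 1`; the set `Y` collects
their elements outside the core. There are at least `k - d` of them. -/
structure IsCore (n k d : ℕ) (𝓕 : Finset (Finset ℕ)) (X Y : Finset ℕ) : Prop where
  maximal : IsMaximalNontrivial n k d 𝓕
  three_le : 3 ≤ d
  add_two_le : d + 2 ≤ k
  card_X : #X + 1 = d
  X_subset : X ⊆ Icc 1 n
  mem_Y : ∀ y, y ∈ Y ↔ y ∈ Icc 1 n ∧ y ∉ X ∧ IsCover d 𝓕 (insert y X)
  le_card_Y : k - d ≤ #Y

namespace IsCore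
variable {X Y : Finset ℕ} (h : IsCore n k d 𝓕 X Y)
include h

lemma nonempty_Y : Y.Nonempty := by
  have := h.le_card_Y
  have := h.add_two_le
  exact card_pos.1 (by omega)

lemma disjoint : Disjoint X Y :=
  disjoint_right.2 fun y hy => ((h.mem_Y y).1 hy).2.1

lemma Y_subset : Y ⊆ Icc 1 n := fun y hy => ((h.mem_Y y).1 hy).1

lemma subset_of_notMem {F : Finset ℕ} (hF : F ∈ 𝓕) {x : ℕ} (hx : x ∈ X) (hxF : x ∉ F) :
    X.erase x ⊆ F ∧ Y ⊆ F := by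
  have key : ∀ y ∈ Y, (insert y X).erase x ⊆ F := by
    intro y hy
    obtain ⟨-, hyX, hcov⟩ := (h.mem_Y y).1 hy
    have h1 := h.maximal.le_card_inter hcov hF
    have h2 : F ∩ insert y X = (insert y X).erase x := by
      refine eq_of_subset_of_card_le (fun z hz => ?_) ?_
      · rw [mem_inter] at hz
        exact mem_erase.2 ⟨fun e => hxF (e ▸ hz.1), hz.2⟩
      · rw [card_erase_of_mem (mem_insert_of_mem hx), card_insert_of_notMem hyX]
        have := h.card_X
        omega
    exact h2 ▸ inter_subset_left
  refine ⟨?_, fun y hy => key y hy (mem_erase.2 ⟨?_, mem_insert_self _ _⟩)⟩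
  · obtain ⟨y, hy⟩ := h.nonempty_Y
    exact (erase_subset_erase _ (subset_insert _ _)).trans (key y hy)
  · rintro rfl
    exact disjoint_left.1 h.disjoint hx hy

/-- A vertex contained in all members not containing `X` belongs to `Y`. -/
lemma mem_Y_of_forall {z : ℕ} (hz : ∀ F ∈ 𝓕, ∀ x ∈ X, x ∉ F → z ∈ F) (hzn : z ∈ Icc 1 n)
    (hzX : z ∉ X) : z ∈ Y := by
  refine (h.mem_Y z).2 ⟨hzn, hzX, fun s hs hsd => ?_⟩
  by_cases hcom : ∃ x ∈ X, ∀ F ∈ s, x ∈ F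
  · obtain ⟨x, hx, hxs⟩ := hcom
    exact ⟨x, mem_insert_of_mem hx, hxs⟩
  push Not at hcom
  obtain ⟨f, hf, hfc⟩ := exists_missing
    (fun F hF x hx hxF => (h.subset_of_notMem (hs hF) hx hxF).1) hcom
  refine ⟨z, mem_insert_self _ _, fun F hF => ?_⟩
  have hs_eq : X.image f = s := by
    refine eq_of_subset_of_card_le (image_subset_iff.2 fun x hx => (hf x hx).1) ?_
    have := h.card_X
    omega
  rw [← hs_eq, mem_image] at hF
  obtain ⟨x, hx, rfl⟩ := hF
  exact hz _ (hs (hf x hx).1) x hx (hf x hx).2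

lemma exists_common {A : Finset ℕ} (hA : A ∈ 𝓕) (hAY : ∀ y ∈ Y, y ∉ A) {f : ℕ → Finset ℕ}
    (hf : ∀ x ∈ X, f x ∈ 𝓕 ∧ x ∉ f x) :
    ∃ u ∈ A, u ∉ X ∪ Y ∧ ∀ x ∈ X, u ∈ f x := by
  obtain ⟨u, hu⟩ := isIntersecting_iff.1 h.maximal.intersecting (insert A (X.image f))
    (insert_subset hA (image_subset_iff.2 fun x hx => (hf x hx).1)) (by
      have h1 := card_insert_le A (X.image f)
      have h2 := card_image_le (s := X) (f := f)
      have := h.card_X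
      omega)
  have hux : ∀ x ∈ X, u ∈ f x := fun x hx =>
    hu _ (mem_insert_of_mem (mem_image_of_mem f hx))
  have huA := hu A (mem_insert_self _ _)
  refine ⟨u, huA, fun huXY => ?_, hux⟩
  rcases mem_union.1 huXY with huX | huY
  · exact (hf u huX).2 (hux u huX)
  · exact hAY u huY huA

lemma card_sdiff_add {F : Finset ℕ} (hF : F ∈ 𝓕) {x : ℕ} (hx : x ∈ X) (hxF : x ∉ F) :
    #(F \ (X ∪ Y)) + (d - 2) + #Y = k := by
  obtain ⟨h1, h2⟩ := h.subset_of_notMem hF hx hxF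
  have h3 : F ∩ (X ∪ Y) = X.erase x ∪ Y := by
    ext z
    simp only [mem_inter, mem_union, mem_erase]
    constructor
    · rintro ⟨hz, hz' | hz'⟩
      · exact Or.inl ⟨fun e => hxF (e ▸ hz), hz'⟩
      · exact Or.inr hz'
    · rintro (hz | hz)
      · exact ⟨h1 (mem_erase.2 hz), Or.inl hz.2⟩
      · exact ⟨h2 hz, Or.inr hz⟩
  have h4 := card_sdiff_add_card_inter F (X ∪ Y)
  rw [h3, card_union_of_disjoint (h.disjoint.mono_left (erase_subset _ _)), card_erase_of_mem hx,
    (mem_uniform.1 (h.maximal.subset_uniform hF)).2] at h4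
  have := h.card_X
  have := card_pos.2 ⟨x, hx⟩
  omega

lemma nonempty_X : X.Nonempty := by
  have := h.card_X
  have := h.three_le
  exact card_pos.1 (by omega)

lemma exists_notMem {x : ℕ} (hx : x ∈ X) : ∃ F ∈ 𝓕, x ∉ F :=
  h.maximal.exists_notMem (h.X_subset hx)

lemma card_Y_le : #Y ≤ k - d + 2 := by
  obtain ⟨x, hx⟩ := h.nonempty_X
  obtain ⟨F, hF, hxF⟩ := h.exists_notMem hx
  have := h.card_sdiff_add hF hx hxF
  have := h.three_le
  have := h.add_two_le
  omega

/-- If every member containing `X` meets `Y`, the family is `H(k,d,#Y)`. -/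
lemma iso_H (hall : ∀ A ∈ 𝓕, X ⊆ A → ∃ y ∈ Y, y ∈ A) : Iso n 𝓕 (H n k d #Y) := by
  have hd : 2 ≤ d := by have := h.three_le; omega
  have hl : 1 ≤ #Y := card_pos.2 h.nonempty_Y
  obtain ⟨π, hπ, hst⟩ := exists_stacking n [X, Y] (by simp [h.X_subset, h.Y_subset])
    (by simp [h.disjoint])
  have hX : #X = d - 1 := by have := h.card_X; omega
  simp only [IsStacking, zero_add, and_true, hX] at hst
  rw [show d - 1 + 1 = d by omega, show d - 1 + #Y = d + #Y - 1 by omega] at hst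
  refine h.maximal.iso π hπ (fun F hF => ((mem_H_iff hd hl).1 hF).1)
    (isIntersecting_H hd hl) fun F hF => ?_
  refine (mem_H_iff hd hl).2 ⟨image_mem_uniform (h.maximal.subset_uniform hF) π hπ, ?_⟩
  have hT : IsOfType X Y Y (fun _ _ => True) F := by
    by_cases hXF : X ⊆ F
    · exact Or.inl ⟨hXF, hall F hF hXF⟩
    · obtain ⟨x, hx, hxF⟩ := not_subset.1 hXF
      have := h.subset_of_notMem hF hx hxF
      exact Or.inr (Or.inr ⟨x, hx, hxF, this.1, this.2, trivial⟩)
  have := hT.image (E' := fun _ _ => True) π (fun _ _ _ _ => trivial)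
  rwa [hst.1, hst.2] at this

/-- Otherwise there are exactly `k - d` covers of size `d`: for `k - d + 1` of them the members
missing one element of `X` would share a further vertex, which gives one more cover, and for
`k - d + 2` of them they would leave no room for an intersection. -/
lemma card_Y_eq {A : Finset ℕ} (hA : A ∈ 𝓕) (hAY : ∀ y ∈ Y, y ∉ A) : #Y = k - d := by
  have h3 := h.three_le
  have hk := h.add_two_le
  have hX := h.card_X
  choose! f hf using fun x (hx : x ∈ X) => h.exists_notMem hx
  obtain ⟨u, huA, huXY, hu⟩ := h.exists_common hA hAY hf
  have hmem : ∀ x ∈ X, u ∈ f x \ (X ∪ Y) := fun x hx => mem_sdiff.2 ⟨hu x hx, huXY⟩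
  by_contra hne
  have hle := h.le_card_Y
  have huY : u ∉ Y := fun h => huXY (mem_union_right _ h)
  refine huY (h.mem_Y_of_forall (fun F hF x hx hxF => ?_)
    ((mem_uniform.1 (h.maximal.subset_uniform hA)).1 huA) fun h => huXY (mem_union_left _ h))
  -- The members `F` and `f z`, `z ≠ x`, meet outside `X ∪ Y`, where `f z` has only `u`.
  obtain ⟨z, hz, hzx⟩ := exists_mem_ne (show 1 < #X by omega) x
  obtain ⟨v, hvA, hvXY, hv⟩ := h.exists_common hA hAY (f := Function.update f x F) (by
    intro w hw
    by_cases hwx : w = x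
    · subst hwx
      simpa using ⟨hF, hxF⟩
    · rw [Function.update_of_ne hwx]
      exact hf w hw)
  have hvF : v ∈ F := by simpa using hv x hx
  have hvz : v ∈ f z \ (X ∪ Y) := by
    have := hv z hz
    rw [Function.update_of_ne hzx] at this
    exact mem_sdiff.2 ⟨this, hvXY⟩
  have hc := h.card_sdiff_add (hf z hz).1 hz (hf z hz).2
  have : u = v := card_le_one.1 (show #(f z \ (X ∪ Y)) ≤ 1 by omega) u (hmem z hz) v hvz
  exact this ▸ hvF

end IsCore
end Structure

/-! ### Remainders of the members missing an element of the core -/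

section Remainders
variable {n k d : ℕ} {𝓕 : Finset (Finset ℕ)} {X Y : Finset ℕ}

/-- The graph of the parts outside `X ∪ Y` of the members missing `x`. -/
def remainders (𝓕 : Finset (Finset ℕ)) (X Y : Finset ℕ) (x : ℕ) : Set (Finset ℕ) :=
  {r | ∃ F ∈ 𝓕, x ∉ F ∧ F \ (X ∪ Y) = r}

namespace IsCore
variable (h : IsCore n k d 𝓕 X Y)
include h

lemma remainders_nonempty {x : ℕ} (hx : x ∈ X) : (remainders 𝓕 X Y x).Nonempty := by
  obtain ⟨F, hF, hxF⟩ := h.exists_notMem hx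
  exact ⟨_, F, hF, hxF, rfl⟩

lemma card_of_mem_remainders (hY : #Y = k - d) {x : ℕ} (hx : x ∈ X) {r : Finset ℕ}
    (hr : r ∈ remainders 𝓕 X Y x) : #r = 2 := by
  obtain ⟨F, hF, hxF, rfl⟩ := hr
  have := h.card_sdiff_add hF hx hxF
  have := h.three_le
  have := h.add_two_le
  omega

lemma exists_common_remainders {A : Finset ℕ} (hA : A ∈ 𝓕) (hAY : ∀ y ∈ Y, y ∉ A)
    {f : ℕ → Finset ℕ} (hf : ∀ x ∈ X, f x ∈ remainders 𝓕 X Y x) :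
    ∃ u ∈ A, u ∉ X ∪ Y ∧ ∀ x ∈ X, u ∈ f x := by
  choose! g hg1 hg2 hg3 using hf
  obtain ⟨u, huA, huXY, hu⟩ := h.exists_common hA hAY fun x hx => ⟨hg1 x hx, hg2 x hx⟩
  exact ⟨u, huA, huXY, fun x hx => hg3 x hx ▸ mem_sdiff.2 ⟨hu x hx, huXY⟩⟩

lemma mem_of_isIsolated {A : Finset ℕ} (hA : A ∈ 𝓕) (hAY : ∀ y ∈ Y, y ∉ A) {u : ℕ}
    (hu : IsIsolated X (remainders 𝓕 X Y) u) : u ∈ A ∧ u ∉ X ∪ Y := by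
  obtain ⟨f, hf, huv⟩ := hu
  obtain ⟨v, hvA, hvXY, hv⟩ := h.exists_common_remainders hA hAY hf
  obtain rfl := huv v hv
  exact ⟨hvA, hvXY⟩

/-- No vertex lies in all the remainders: it would give a further cover of size `d`. -/
lemma exists_notMem_remainders (v : ℕ) :
    ∃ x ∈ X, ∃ r ∈ remainders 𝓕 X Y x, v ∉ r := by
  by_contra! hv
  have hvF : ∀ F ∈ 𝓕, ∀ x ∈ X, x ∉ F → v ∈ F \ (X ∪ Y) := fun F hF x hx hxF =>
    hv x hx _ ⟨F, hF, hxF, rfl⟩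
  obtain ⟨x, hx⟩ := h.nonempty_X
  obtain ⟨F, hF, hxF⟩ := h.exists_notMem hx
  obtain ⟨hvF', hvXY⟩ := mem_sdiff.1 (hvF F hF x hx hxF)
  refine hvXY (mem_union_right _ (h.mem_Y_of_forall (fun F hF x hx hxF =>
    (mem_sdiff.1 (hvF F hF x hx hxF)).1)
    ((mem_uniform.1 (h.maximal.subset_uniform hF)).1 hvF') fun hvX => hvXY ?_))
  exact mem_union_left _ hvX

lemma isOfType {U : Finset ℕ} (hU : ∀ u ∈ U, IsIsolated X (remainders 𝓕 X Y) u) {F : Finset ℕ}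
    (hF : F ∈ 𝓕) : IsOfType X Y U (fun x F => F \ (X ∪ Y) ∈ remainders 𝓕 X Y x) F := by
  by_cases hXF : X ⊆ F
  · by_cases hYF : ∃ y ∈ Y, y ∈ F
    · exact Or.inl ⟨hXF, hYF⟩
    · push Not at hYF
      exact Or.inr (Or.inl ⟨hXF, fun u hu => (h.mem_of_isIsolated hF hYF (hU u hu)).1⟩)
  · obtain ⟨x, hx, hxF⟩ := not_subset.1 hXF
    obtain ⟨h1, h2⟩ := h.subset_of_notMem hF hx hxF
    exact Or.inr (Or.inr ⟨x, hx, hxF, h1, h2, F, hF, hxF, rfl⟩)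

/-- A permutation moving `X`, `Y` and the isolated vertices `U` to their positions in a
`d`-wise intersecting family of sets of the three shapes gives an isomorphism, once the conditions
on the remainders match. -/
lemma iso_of_perm {𝓖 : Finset (Finset ℕ)} {X₀ Y₀ U₀ U : Finset ℕ} {E : ℕ → Finset ℕ → Prop}
    (h𝓖 : ∀ F, F ∈ 𝓖 ↔ F ∈ uniform n k ∧ IsOfType X₀ Y₀ U₀ E F) (hi : IsIntersecting d 𝓖)
    (π : Equiv.Perm ℕ) (hπ : ∀ x, π x ∈ Icc 1 n ↔ x ∈ Icc 1 n) (hX : X.image π = X₀)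
    (hY : Y.image π = Y₀) (hUπ : U.image π = U₀)
    (hU : ∀ u ∈ U, IsIsolated X (remainders 𝓕 X Y) u)
    (hE : ∀ x ∈ X, ∀ F, F \ (X ∪ Y) ∈ remainders 𝓕 X Y x → E (π x) (F.image π)) :
    Iso n 𝓕 𝓖 := by
  refine h.maximal.iso π hπ (fun F hF => ((h𝓖 F).1 hF).1) hi fun F hF => ?_
  refine (h𝓖 _).2 ⟨image_mem_uniform (h.maximal.subset_uniform hF) π hπ, ?_⟩
  have := (h.isOfType hU hF).image (E' := E) π fun x hx _ hr => hE x hx F hr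
  rwa [hX, hY, hUπ] at this

lemma isolated_mem {A : Finset ℕ} (hA : A ∈ 𝓕) (hAY : ∀ y ∈ Y, y ∉ A) {u : ℕ}
    (hu : IsIsolated X (remainders 𝓕 X Y) u) : u ∈ Icc 1 n ∧ u ∉ X ∧ u ∉ Y := by
  obtain ⟨h1, h2⟩ := h.mem_of_isIsolated hA hAY hu
  rw [mem_union, not_or] at h2
  exact ⟨(mem_uniform.1 (h.maximal.subset_uniform hA)).1 h1, h2⟩

end IsCore

lemma isIntersecting_G (hd : 3 ≤ d) (hk : d + 1 ≤ k) : IsIntersecting d (G n k d) := by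
  refine isIntersecting_of_isOfType (X := Icc 1 (d - 1)) (Y := Icc d (k - 1)) (by
    rw [Nat.card_Icc]; omega) (nonempty_Icc.2 (by omega))
    (fun F hF => ((mem_G_iff hd hk).1 hF).2) fun f hf => ?_
  have h1 := (hf 1 (mem_Icc.2 (by omega))).2.2.2
  have h2 : ∀ x ∈ Icc 1 (d - 1), x ≠ 1 → k ∈ f x ∧ k + 1 ∈ f x := fun x hx hx1 =>
    (hf x hx).2.2.2.resolve_left fun h => hx1 h.1
  have h3 : k ∈ f 1 ∨ k + 1 ∈ f 1 := by
    rcases h1 with h | h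
    · exact h.2
    · exact Or.inl h.1
  rcases h3 with h3 | h3
  · refine ⟨k, by simp, fun x hx => ?_⟩
    by_cases hx1 : x = 1
    · exact hx1 ▸ h3
    · exact (h2 x hx hx1).1
  · refine ⟨k + 1, by simp, fun x hx => ?_⟩
    by_cases hx1 : x = 1
    · exact hx1 ▸ h3
    · exact (h2 x hx hx1).2

lemma IsCore.iso_G (h : IsCore n k d 𝓕 X Y) {A : Finset ℕ} (hA : A ∈ 𝓕)
    (hAY : ∀ y ∈ Y, y ∉ A) (hg : GraphG X (remainders 𝓕 X Y)) : Iso n 𝓕 (G n k d) := by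
  have hd := h.three_le
  have hk := h.add_two_le
  have hY := h.card_Y_eq hA hAY
  obtain ⟨x₀, hx₀, a, b, hab, h1, h2, ha, hb⟩ := hg
  obtain ⟨han, haX, haY⟩ := h.isolated_mem hA hAY ha
  obtain ⟨hbn, hbX, hbY⟩ := h.isolated_mem hA hAY hb
  have hX : #(X.erase x₀) = d - 2 := by
    rw [card_erase_of_mem hx₀]
    have := h.card_X
    omega
  obtain ⟨π, hπ, hst⟩ := exists_stacking n [{x₀}, X.erase x₀, Y, {a}, {b}] (by
      simp only [List.mem_cons, List.not_mem_nil, or_false, forall_eq_or_imp, forall_eq,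
        singleton_subset_iff]
      exact ⟨h.X_subset hx₀, (erase_subset _ _).trans h.X_subset, h.Y_subset, han, hbn⟩) (by
      simp only [List.pairwise_cons, List.mem_cons, List.not_mem_nil, or_false, forall_eq_or_imp,
        forall_eq, disjoint_singleton_left, disjoint_singleton_right, mem_singleton,
        List.Pairwise.nil, and_true, IsEmpty.forall_iff, implies_true, mem_erase, not_and]
      refine ⟨⟨by simp, disjoint_left.1 h.disjoint hx₀, ?_, ?_⟩, ⟨h.disjoint.mono_left
        (erase_subset _ _), fun _ => haX, fun _ => hbX⟩, ⟨haY, hbY⟩, hab⟩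
      · rintro rfl
        exact haX hx₀
      · rintro rfl
        exact hbX hx₀)
  simp only [IsStacking, zero_add, and_true, hX, hY, image_singleton, card_singleton, Icc_self,
    singleton_inj] at hst
  obtain ⟨e1, e2, e3, e4, e5⟩ := hst
  refine h.iso_of_perm (fun F => mem_G_iff hd (by omega)) (isIntersecting_G hd (by omega)) π hπ
    (U := {a, b}) ?_ ?_ ?_ ?_ ?_
  · rw [← insert_erase hx₀, image_insert, e1, e2]
    ext x
    simp only [mem_insert, mem_Icc]
    omega
  · rw [e3]
    congr 1 <;> omega
  · rw [image_insert, image_singleton, e4, e5]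
    congr 2 <;> omega
  · simp [ha, hb]
  · intro x hx F hr
    by_cases hxx : x = x₀
    · subst hxx
      refine Or.inl ⟨e1, ?_⟩
      rcases h2 _ hr with hm | hm
      · refine Or.inl (mem_image.2 ⟨a, (mem_sdiff.1 hm).1, by omega⟩)
      · refine Or.inr (mem_image.2 ⟨b, (mem_sdiff.1 hm).1, by omega⟩)
    · obtain ⟨hm, hm'⟩ := h1 x hx hxx _ hr
      exact Or.inr ⟨mem_image.2 ⟨a, (mem_sdiff.1 hm).1, by omega⟩,
        mem_image.2 ⟨b, (mem_sdiff.1 hm').1, by omega⟩⟩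

lemma isIntersecting_three {𝓖 : Finset (Finset ℕ)} {U : Finset ℕ} {E : ℕ → Finset ℕ → Prop}
    (hk : 4 ≤ k) (h𝓖 : ∀ F ∈ 𝓖, IsOfType (Icc 1 2) (Icc 3 (k - 1)) U E F)
    (hE : ∀ F F', E 1 F → E 2 F' → ∃ u ∈ U, u ∈ F ∧ u ∈ F') : IsIntersecting 3 𝓖 := by
  refine isIntersecting_of_isOfType (X := Icc 1 2) (by simp)
    (nonempty_Icc.2 (by omega)) h𝓖 fun f hf => ?_
  obtain ⟨u, hu, h1, h2⟩ := hE (f 1) (f 2) (hf 1 (by simp)).2.2.2 (hf 2 (by simp)).2.2.2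
  refine ⟨u, hu, fun x hx => ?_⟩
  obtain rfl | rfl : x = 1 ∨ x = 2 := by rw [mem_Icc] at hx; omega
  · exact h1
  · exact h2

lemma exists_mem_Icc_add_two {F F' : Finset ℕ}
    (h : (k ∈ F ∧ k ∈ F') ∨ (k + 1 ∈ F ∧ k + 1 ∈ F') ∨ (k + 2 ∈ F ∧ k + 2 ∈ F')) :
    ∃ u ∈ Icc k (k + 2), u ∈ F ∧ u ∈ F' := by
  rcases h with h | h | h
  · exact ⟨k, by simp, h⟩
  · exact ⟨k + 1, by simp, h⟩
  · exact ⟨k + 2, by simp, h⟩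

lemma exists_mem_Icc_add_three {F F' : Finset ℕ}
    (h : (k ∈ F ∧ k ∈ F') ∨ (k + 1 ∈ F ∧ k + 1 ∈ F') ∨ (k + 2 ∈ F ∧ k + 2 ∈ F') ∨
      (k + 3 ∈ F ∧ k + 3 ∈ F')) : ∃ u ∈ Icc k (k + 3), u ∈ F ∧ u ∈ F' := by
  rcases h with h | h | h | h
  · exact ⟨k, by simp, h⟩
  · exact ⟨k + 1, by simp, h⟩
  · exact ⟨k + 2, by simp, h⟩
  · exact ⟨k + 3, by simp, h⟩

lemma isIntersecting_S (hk : 5 ≤ k) : IsIntersecting 3 (S n k) :=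
  isIntersecting_three (by omega) (fun _ hF => ((mem_S_iff hk).1 hF).2) fun F F' h h' =>
    exists_mem_Icc_add_two (by simp only [ES] at h h'; tauto)

lemma isIntersecting_S₁ (hk : 5 ≤ k) (hn : k + 2 ≤ n) : IsIntersecting 3 (S₁ n k) :=
  isIntersecting_three (by omega) (fun _ hF => ((mem_S₁_iff hk hn).1 hF).2) fun F F' h h' =>
    exists_mem_Icc_add_two (by
      simp only [ES₁, true_and, OfNat.one_ne_ofNat, OfNat.ofNat_ne_one, false_and, or_false,
        false_or] at h h'
      tauto)

lemma isIntersecting_S₂ (hk : 6 ≤ k) (hn : k + 3 ≤ n) : IsIntersecting 3 (S₂ n k) :=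
  isIntersecting_three (by omega) (fun _ hF => ((mem_S₂_iff hk hn).1 hF).2) fun F F' h h' =>
    exists_mem_Icc_add_three (by
      simp only [ES₂, true_and, OfNat.one_ne_ofNat, OfNat.ofNat_ne_one, false_and, or_false,
        false_or] at h h'
      tauto)

lemma isIntersecting_S₃ (hk : 6 ≤ k) (hn : k + 3 ≤ n) : IsIntersecting 3 (S₃ n k) :=
  isIntersecting_three (by omega) (fun _ hF => ((mem_S₃_iff hk hn).1 hF).2) fun F F' h h' =>
    exists_mem_Icc_add_three (by
      simp only [ES₃, true_and, OfNat.one_ne_ofNat, OfNat.ofNat_ne_one, false_and, or_false,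
        false_or] at h h'
      tauto)

end Remainders

/-! ### Classification -/

section Three
variable {n k d : ℕ} {𝓕 : Finset (Finset ℕ)} {X Y : Finset ℕ}

lemma IsIsolated₂.isIsolated {R : ℕ → Set (Finset ℕ)} {x₁ x₂ u : ℕ} (hne : x₁ ≠ x₂)
    (h : IsIsolated₂ (R x₁) (R x₂) u) : IsIsolated {x₁, x₂} R u := by
  obtain ⟨p, hp, q, hq, hpq⟩ := h
  refine ⟨fun x => if x = x₁ then p else q, ?_, fun v hv => ?_⟩
  · simp [hp, hq, hne.symm]
  · simp only [mem_insert, mem_singleton, forall_eq_or_imp, forall_eq, if_true,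
      if_neg hne.symm] at hv
    exact hpq v hv.1 hv.2

lemma PairG.graphG {R : ℕ → Set (Finset ℕ)} {x₁ x₂ : ℕ} (hne : x₁ ≠ x₂)
    (h : PairG (R x₁) (R x₂)) : GraphG {x₁, x₂} R := by
  obtain ⟨a, b, hab, h1, h2, ha, hb⟩ := h
  refine ⟨x₁, by simp, a, b, hab, fun x hx hxx r hr => ?_, h2, ha.isIsolated hne,
    hb.isIsolated hne⟩
  obtain rfl : x = x₂ := by
    rw [mem_insert, mem_singleton] at hx
    exact hx.resolve_left hxx
  exact h1 r hr

/-- For `d = 3`, the core can be moved to `[2]`, `Y` to `[3,k-1]`, and any isolated vertices to the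
positions from `k` on; the members containing the core and missing `Y` show that there is room for
the isolated vertices in a `k`-set. -/
lemma IsCore.exists_perm_three {x₁ x₂ : ℕ} (hne : x₁ ≠ x₂) (h : IsCore n k 3 𝓕 {x₁, x₂} Y)
    {A : Finset ℕ} (hA : A ∈ 𝓕) (hAY : ∀ y ∈ Y, y ∉ A) {W : List ℕ} (hW : W.Nodup)
    (hiso : ∀ u ∈ W, IsIsolated₂ (remainders 𝓕 {x₁, x₂} Y x₁) (remainders 𝓕 {x₁, x₂} Y x₂) u) :
    2 + W.length ≤ k ∧ ∃ π : Equiv.Perm ℕ, (∀ x, π x ∈ Icc 1 n ↔ x ∈ Icc 1 n) ∧ π x₁ = 1 ∧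
      π x₂ = 2 ∧ Y.image π = Icc 3 (k - 1) ∧ IsStacking π (k - 1) (W.map fun u => {u}) := by
  have hk := h.add_two_le
  have hY := h.card_Y_eq hA hAY
  have hWm := fun u hu => h.isolated_mem hA hAY ((hiso u hu).isIsolated hne)
  have hxA : ({x₁, x₂} : Finset ℕ) ⊆ A := by
    by_contra hsub
    obtain ⟨x, hx, hxA⟩ := not_subset.1 hsub
    obtain ⟨y, hy⟩ := h.nonempty_Y
    exact hAY y hy ((h.subset_of_notMem hA hx hxA).2 hy)
  have hx₁ : x₁ ∉ Y := disjoint_left.1 h.disjoint (by simp)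
  have hx₂ : x₂ ∉ Y := disjoint_left.1 h.disjoint (by simp)
  have hWX : ∀ u ∈ W, u ≠ x₁ ∧ u ≠ x₂ := fun u hu => by
    have := (hWm u hu).2.1
    rw [mem_insert, mem_singleton, not_or] at this
    exact this
  constructor
  · have h1 : ({x₁, x₂} : Finset ℕ) ∪ W.toFinset ⊆ A := union_subset hxA fun u hu =>
      (h.mem_of_isIsolated hA hAY ((hiso u (List.mem_toFinset.1 hu)).isIsolated hne)).1
    have h2 := card_le_card h1
    rw [card_union_of_disjoint, card_pair hne, List.toFinset_card_of_nodup hW,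
      (mem_uniform.1 (h.maximal.subset_uniform hA)).2] at h2
    · exact h2
    · exact disjoint_right.2 fun u hu => (hWm u (List.mem_toFinset.1 hu)).2.1
  · obtain ⟨π, hπ, hst⟩ := exists_stacking n ({x₁} :: {x₂} :: Y :: W.map fun u => {u}) (by
        intro Z hZ
        simp only [List.mem_cons, List.mem_map] at hZ
        rcases hZ with rfl | rfl | rfl | ⟨u, hu, rfl⟩
        · exact singleton_subset_iff.2 (h.X_subset (by simp))
        · exact singleton_subset_iff.2 (h.X_subset (by simp))
        · exact h.Y_subset
        · exact singleton_subset_iff.2 (hWm u hu).1) (by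
        simp only [List.pairwise_cons, List.mem_cons, List.mem_map, forall_eq_or_imp,
          disjoint_singleton_left, mem_singleton, forall_exists_index, and_imp,
          forall_apply_eq_imp_iff₂, disjoint_singleton_right, List.pairwise_map]
        refine ⟨⟨hne, hx₁, fun u hu => (hWX u hu).1.symm⟩, ⟨hx₂, fun u hu => (hWX u hu).2.symm⟩,
          fun u hu => (hWm u hu).2.2, hW.imp Ne.symm⟩)
    simp only [IsStacking, zero_add, hY, image_singleton, card_singleton, Icc_self,
      singleton_inj] at hst
    obtain ⟨e1, e2, e3, e4⟩ := hst
    rw [show 1 + 1 + (k - 3) = k - 1 by omega] at e3 e4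
    exact ⟨π, hπ, e1, e2, e3, e4⟩

lemma mem_image_of_mem_sdiff {F Z : Finset ℕ} {π : Equiv.Perm ℕ} {u v : ℕ} (h : u ∈ F \ Z)
    (hv : π u = v) : v ∈ F.image π :=
  mem_image.2 ⟨u, (mem_sdiff.1 h).1, hv⟩

lemma IsCore.iso_S {x₁ x₂ : ℕ} (hne : x₁ ≠ x₂) (h : IsCore n k 3 𝓕 {x₁, x₂} Y)
    {A : Finset ℕ} (hA : A ∈ 𝓕) (hAY : ∀ y ∈ Y, y ∉ A)
    (hp : PairS (remainders 𝓕 {x₁, x₂} Y x₁) (remainders 𝓕 {x₁, x₂} Y x₂)) : Iso n 𝓕 (S n k) := by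
  obtain ⟨a, b, c, hnd, hr, ha, hb, hc⟩ := hp
  obtain ⟨hk, π, hπ, e1, e2, hY, hst⟩ := h.exists_perm_three hne hA hAY hnd (by simp [ha, hb, hc])
  simp only [List.length_cons, List.length_nil] at hk
  simp only [List.map_cons, List.map_nil, IsStacking, image_singleton, card_singleton, Icc_self,
    singleton_inj, and_true] at hst
  obtain ⟨ea, eb, ec⟩ : π a = k ∧ π b = k + 1 ∧ π c = k + 2 := by omega
  refine h.iso_of_perm (fun F => mem_S_iff (by omega)) (isIntersecting_S (by omega)) π hπ
    (U := {a, b, c}) ?_ hY ?_ ?_ ?_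
  · rw [image_insert, image_singleton, e1, e2]
    rfl
  · rw [image_insert, image_insert, image_singleton, ea, eb, ec]
    ext x
    simp only [mem_insert, mem_singleton, mem_Icc]
    omega
  · simp [ha.isIsolated hne, hb.isIsolated hne, hc.isIsolated hne]
  · intro x hx F hF
    have hF' : F \ ({x₁, x₂} ∪ Y) ∈ remainders 𝓕 {x₁, x₂} Y x₁ ∨
        F \ ({x₁, x₂} ∪ Y) ∈ remainders 𝓕 {x₁, x₂} Y x₂ := by
      rw [mem_insert, mem_singleton] at hx
      rcases hx with rfl | rfl
      · exact Or.inl hF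
      · exact Or.inr hF
    exact (hr _ hF').imp (fun h => ⟨mem_image_of_mem_sdiff h.1 ea, mem_image_of_mem_sdiff h.2 eb⟩)
      (Or.imp (fun h => ⟨mem_image_of_mem_sdiff h.1 ea, mem_image_of_mem_sdiff h.2 ec⟩)
        (fun h => ⟨mem_image_of_mem_sdiff h.1 eb, mem_image_of_mem_sdiff h.2 ec⟩))

lemma IsCore.iso_S₁ {x₁ x₂ : ℕ} (hne : x₁ ≠ x₂) (h : IsCore n k 3 𝓕 {x₁, x₂} Y)
    (hn : k + 2 ≤ n) {A : Finset ℕ} (hA : A ∈ 𝓕) (hAY : ∀ y ∈ Y, y ∉ A)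
    (hp : PairS₁ (remainders 𝓕 {x₁, x₂} Y x₁) (remainders 𝓕 {x₁, x₂} Y x₂)) :
    Iso n 𝓕 (S₁ n k) := by
  obtain ⟨a, b, c, hnd, hr, hr', ha, hb, hc⟩ := hp
  obtain ⟨hk, π, hπ, e1, e2, hY, hst⟩ := h.exists_perm_three hne hA hAY hnd (by simp [ha, hb, hc])
  simp only [List.length_cons, List.length_nil] at hk
  simp only [List.map_cons, List.map_nil, IsStacking, image_singleton, card_singleton, Icc_self,
    singleton_inj, and_true] at hst
  obtain ⟨ea, eb, ec⟩ : π a = k ∧ π b = k + 1 ∧ π c = k + 2 := by omega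
  refine h.iso_of_perm (fun F => mem_S₁_iff (by omega) hn) (isIntersecting_S₁ (by omega) hn) π hπ
    (U := {a, b, c}) ?_ hY ?_ ?_ ?_
  · rw [image_insert, image_singleton, e1, e2]
    rfl
  · rw [image_insert, image_insert, image_singleton, ea, eb, ec]
    ext x
    simp only [mem_insert, mem_singleton, mem_Icc]
    omega
  · simp [ha.isIsolated hne, hb.isIsolated hne, hc.isIsolated hne]
  · intro x hx F hF
    rw [mem_insert, mem_singleton] at hx
    have ma := fun h => mem_image_of_mem_sdiff (F := F) (Z := {x₁, x₂} ∪ Y) h ea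
    have mb := fun h => mem_image_of_mem_sdiff (F := F) (Z := {x₁, x₂} ∪ Y) h eb
    have mc := fun h => mem_image_of_mem_sdiff (F := F) (Z := {x₁, x₂} ∪ Y) h ec
    rcases hx with rfl | rfl
    · exact Or.inl ⟨e1, (hr _ hF).imp ma (And.imp mb mc)⟩
    · exact Or.inr ⟨e2, (hr' _ hF).imp ma (Or.imp mb mc)⟩

lemma IsCore.iso_S₂ {x₁ x₂ : ℕ} (hne : x₁ ≠ x₂) (h : IsCore n k 3 𝓕 {x₁, x₂} Y)
    (hn : k + 3 ≤ n) {A : Finset ℕ} (hA : A ∈ 𝓕) (hAY : ∀ y ∈ Y, y ∉ A)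
    (hp : PairS₂ (remainders 𝓕 {x₁, x₂} Y x₁) (remainders 𝓕 {x₁, x₂} Y x₂)) :
    6 ≤ k ∧ Iso n 𝓕 (S₂ n k) := by
  obtain ⟨a, b, c, e, hnd, hr, hr', ha, hb, hc, he⟩ := hp
  obtain ⟨hk, π, hπ, e1, e2, hY, hst⟩ :=
    h.exists_perm_three hne hA hAY hnd (by simp [ha, hb, hc, he])
  simp only [List.length_cons, List.length_nil] at hk
  simp only [List.map_cons, List.map_nil, IsStacking, image_singleton, card_singleton, Icc_self,
    singleton_inj, and_true] at hst
  obtain ⟨ea, eb, ec, ee⟩ : π a = k ∧ π b = k + 1 ∧ π c = k + 2 ∧ π e = k + 3 := by omega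
  refine ⟨by omega, h.iso_of_perm (fun F => mem_S₂_iff (by omega) hn)
    (isIntersecting_S₂ (by omega) hn) π hπ (U := {a, b, c, e}) ?_ hY ?_ ?_ ?_⟩
  · rw [image_insert, image_singleton, e1, e2]
    rfl
  · rw [image_insert, image_insert, image_insert, image_singleton, ea, eb, ec, ee]
    ext x
    simp only [mem_insert, mem_singleton, mem_Icc]
    omega
  · simp [ha.isIsolated hne, hb.isIsolated hne, hc.isIsolated hne, he.isIsolated hne]
  · intro x hx F hF
    rw [mem_insert, mem_singleton] at hx
    have ma := fun h => mem_image_of_mem_sdiff (F := F) (Z := {x₁, x₂} ∪ Y) h ea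
    have mb := fun h => mem_image_of_mem_sdiff (F := F) (Z := {x₁, x₂} ∪ Y) h eb
    have mc := fun h => mem_image_of_mem_sdiff (F := F) (Z := {x₁, x₂} ∪ Y) h ec
    have me := fun h => mem_image_of_mem_sdiff (F := F) (Z := {x₁, x₂} ∪ Y) h ee
    rcases hx with rfl | rfl
    · exact Or.inl ⟨e1, (hr _ hF).imp (And.imp ma mb) (Or.imp (And.imp mc me)
        (Or.imp (And.imp ma me) (And.imp mb mc)))⟩
    · exact Or.inr ⟨e2, (hr' _ hF).imp (And.imp ma mc) (And.imp mb me)⟩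

lemma IsCore.iso_S₃ {x₁ x₂ : ℕ} (hne : x₁ ≠ x₂) (h : IsCore n k 3 𝓕 {x₁, x₂} Y)
    (hn : k + 3 ≤ n) {A : Finset ℕ} (hA : A ∈ 𝓕) (hAY : ∀ y ∈ Y, y ∉ A)
    (hp : PairS₃ (remainders 𝓕 {x₁, x₂} Y x₁) (remainders 𝓕 {x₁, x₂} Y x₂)) :
    6 ≤ k ∧ Iso n 𝓕 (S₃ n k) := by
  obtain ⟨a, b, c, e, hnd, hr, hr', ha, hb, hc, he⟩ := hp
  obtain ⟨hk, π, hπ, e1, e2, hY, hst⟩ :=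
    h.exists_perm_three hne hA hAY hnd (by simp [ha, hb, hc, he])
  simp only [List.length_cons, List.length_nil] at hk
  simp only [List.map_cons, List.map_nil, IsStacking, image_singleton, card_singleton, Icc_self,
    singleton_inj, and_true] at hst
  obtain ⟨ea, eb, ec, ee⟩ : π a = k ∧ π b = k + 1 ∧ π c = k + 2 ∧ π e = k + 3 := by omega
  refine ⟨by omega, h.iso_of_perm (fun F => mem_S₃_iff (by omega) hn)
    (isIntersecting_S₃ (by omega) hn) π hπ (U := {a, b, c, e}) ?_ hY ?_ ?_ ?_⟩
  · rw [image_insert, image_singleton, e1, e2]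
    rfl
  · rw [image_insert, image_insert, image_insert, image_singleton, ea, eb, ec, ee]
    ext x
    simp only [mem_insert, mem_singleton, mem_Icc]
    omega
  · simp [ha.isIsolated hne, hb.isIsolated hne, hc.isIsolated hne, he.isIsolated hne]
  · intro x hx F hF
    rw [mem_insert, mem_singleton] at hx
    have ma := fun h => mem_image_of_mem_sdiff (F := F) (Z := {x₁, x₂} ∪ Y) h ea
    have mb := fun h => mem_image_of_mem_sdiff (F := F) (Z := {x₁, x₂} ∪ Y) h eb
    have mc := fun h => mem_image_of_mem_sdiff (F := F) (Z := {x₁, x₂} ∪ Y) h ec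
    have me := fun h => mem_image_of_mem_sdiff (F := F) (Z := {x₁, x₂} ∪ Y) h ee
    rcases hx with rfl | rfl
    · exact Or.inl ⟨e1, (hr _ hF).imp (And.imp ma mc) (Or.imp (And.imp mb mc) (And.imp mb me))⟩
    · exact Or.inr ⟨e2, (hr' _ hF).imp (And.imp ma mb) (Or.imp (And.imp mb mc) (And.imp mc me))⟩

lemma IsCore.iso_of_pairListed {x₁ x₂ : ℕ} (hne : x₁ ≠ x₂) (h : IsCore n k 3 𝓕 {x₁, x₂} Y)
    (hn : k + 3 ≤ n) {A : Finset ℕ} (hA : A ∈ 𝓕) (hAY : ∀ y ∈ Y, y ∉ A)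
    (hp : PairListed (remainders 𝓕 {x₁, x₂} Y x₁) (remainders 𝓕 {x₁, x₂} Y x₂)) :
    Iso n 𝓕 (G n k 3) ∨ Iso n 𝓕 (S n k) ∨ Iso n 𝓕 (S₁ n k) ∨
      (6 ≤ k ∧ (Iso n 𝓕 (S₂ n k) ∨ Iso n 𝓕 (S₃ n k))) := by
  rcases hp with hp | hp | hp | hp | hp
  · exact Or.inl (h.iso_G hA hAY (hp.graphG hne))
  · exact Or.inr (Or.inl (h.iso_S hne hA hAY hp))
  · exact Or.inr (Or.inr (Or.inl (h.iso_S₁ hne (by omega) hA hAY hp)))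
  · have := h.iso_S₂ hne hn hA hAY hp
    exact Or.inr (Or.inr (Or.inr ⟨this.1, Or.inl this.2⟩))
  · have := h.iso_S₃ hne hn hA hAY hp
    exact Or.inr (Or.inr (Or.inr ⟨this.1, Or.inr this.2⟩))

/-- The isomorphism types of the families whose covers of size `d` form a sunflower. -/
lemma IsCore.classification (h : IsCore n k d 𝓕 X Y) (hn : k + 3 ≤ n) :
    Iso n 𝓕 (H n k d (k - d)) ∨ Iso n 𝓕 (H n k d (k - d + 1)) ∨ Iso n 𝓕 (H n k d (k - d + 2)) ∨
      Iso n 𝓕 (G n k d) ∨ (d = 3 ∧ (Iso n 𝓕 (S n k) ∨ Iso n 𝓕 (S₁ n k) ∨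
        (6 ≤ k ∧ (Iso n 𝓕 (S₂ n k) ∨ Iso n 𝓕 (S₃ n k))))) := by
  have hd := h.three_le
  by_cases hall : ∀ A ∈ 𝓕, X ⊆ A → ∃ y ∈ Y, y ∈ A
  · have h1 := h.iso_H hall
    have h2 := h.card_Y_le
    have h3 := h.le_card_Y
    obtain e | e | e : #Y = k - d ∨ #Y = k - d + 1 ∨ #Y = k - d + 2 := by omega
    all_goals rw [e] at h1; simp only [h1, true_or, or_true]
  push Not at hall
  obtain ⟨A, hA, -, hAY⟩ := hall
  have hY := h.card_Y_eq hA hAY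
  have hne := fun x hx => h.remainders_nonempty (x := x) hx
  have hcard := fun x hx r hr => h.card_of_mem_remainders hY (x := x) hx (r := r) hr
  have hcross : ∀ f : ℕ → Finset ℕ, (∀ x ∈ X, f x ∈ remainders 𝓕 X Y x) →
      ∃ v, ∀ x ∈ X, v ∈ f x := fun f hf => by
    obtain ⟨u, -, -, hu⟩ := h.exists_common_remainders hA hAY hf
    exact ⟨u, hu⟩
  have hno := h.exists_notMem_remainders
  refine Or.inr (Or.inr (Or.inr ?_))
  have hX := h.card_X
  by_cases hd3 : d = 3
  · subst hd3
    obtain ⟨x₁, x₂, hx, rfl⟩ := card_eq_two.1 (show #X = 2 by omega)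
    have hp := pairListed_of_cross (hcard x₁ (by simp)) (hcard x₂ (by simp)) (hne x₁ (by simp))
      (hne x₂ (by simp)) (fun p hp q hq => by
        obtain ⟨v, hv⟩ := hcross (fun x => if x = x₁ then p else q) (by simp [hp, hq, hx.symm])
        have h1 := hv x₁ (by simp)
        have h2 := hv x₂ (by simp)
        rw [if_pos rfl] at h1
        rw [if_neg hx.symm] at h2
        exact ⟨v, h1, h2⟩) (fun v => by
        obtain ⟨x, hx, r, hr, hvr⟩ := hno v
        rw [mem_insert, mem_singleton] at hx
        rcases hx with rfl | rfl
        · exact ⟨r, Or.inl hr, hvr⟩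
        · exact ⟨r, Or.inr hr, hvr⟩)
    simp only [true_and]
    rcases hp with hp | hp
    · exact h.iso_of_pairListed hx hn hA hAY hp
    · rw [pair_comm] at h hp
      exact h.iso_of_pairListed hx.symm hn hA hAY hp
  · exact Or.inl (h.iso_G hA hAY (graphG_of_three_le (by omega) hne hcard hcross hno))

lemma IsMaximalNontrivial.classification (h : IsMaximalNontrivial n k d 𝓕) (hd : 3 ≤ d)
    (hk : d + 2 ≤ k) (hn : 2 * k ≤ n) (hc : k - d ≤ #(smallCovers n d 𝓕)) :
    (k ≤ 2 * d + 1 ∧ Iso n 𝓕 (H n k d 2)) ∨ ∃ X Y, IsCore n k d 𝓕 X Y := by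
  have hcov : ∀ T ∈ smallCovers n d 𝓕, (T ⊆ Icc 1 n ∧ #T = d) ∧ IsCover d 𝓕 T := fun T hT => by
    rw [mem_smallCovers, mem_uniform] at hT
    exact hT
  rcases sunflower_or_subset (by omega) (fun T hT => (hcov T hT).1.2)
    (fun T hT T' hT' => h.le_card_inter_covers (by omega) hn (hcov T hT).2 (hcov T' hT').2
      (mem_smallCovers.1 hT).1 (mem_smallCovers.1 hT').1) (by omega) with
    ⟨X, hX, hXT⟩ | ⟨Z, hZT, hZ, hW⟩
  · classical
    refine Or.inr ⟨X, {y ∈ Icc 1 n | y ∉ X ∧ IsCover d 𝓕 (insert y X)}, h, hd, hk, hX, ?_,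
      fun y => by rw [mem_filter], ?_⟩
    · obtain ⟨T, hT⟩ := card_pos.1 (show 0 < #(smallCovers n d 𝓕) by omega)
      exact (hXT T hT).trans (hcov T hT).1.1
    · refine hc.trans ((card_le_card fun T hT => ?_).trans (card_image_le (f := (insert · X))))
      obtain ⟨⟨hTn, hTd⟩, hTc⟩ := hcov T hT
      obtain ⟨y, hyX, rfl⟩ := (exists_eq_insert_iff (s := X) (t := T)).2 ⟨hXT T hT, by omega⟩
      exact mem_image.2 ⟨y, mem_filter.2 ⟨hTn (mem_insert_self _ _), hyX, hTc⟩, rfl⟩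
  · have hZn : Z ⊆ Icc 1 n := hZT.trans (biUnion_subset.2 fun T hT => (hcov T hT).1.1)
    refine Or.inl ⟨?_, h.iso_H_two (by omega) hZn hZ fun F hF =>
      hW F fun T hT => h.le_card_inter (hcov T hT).2 hF⟩
    have hsub : smallCovers n d 𝓕 ⊆ powersetCard d Z := by
      intro T hT
      have h1 := hW T fun T' hT' => h.le_card_inter_covers (by omega) hn (hcov T hT).2
        (hcov T' hT').2 (mem_smallCovers.1 hT).1 (mem_smallCovers.1 hT').1
      have h2 := (hcov T hT).1.2
      have h3 := eq_of_subset_of_card_le (inter_subset_left (s₁ := T) (s₂ := Z)) (by omega)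
      exact mem_powersetCard.2 ⟨inter_eq_left.1 h3, h2⟩
    have := card_le_card hsub
    rw [card_powersetCard, hZ, Nat.choose_succ_self_right] at this
    omega

end Three

end DWise

theorem mainTheorem1 (n k d : ℕ) (hd : 5 ≤ d + 2) (hk : d + 2 ≤ k)
    (hn : d + 2 * (k - d) ^ 2 * (k ^ (k - d) - 1) ^ k * k ! < n)
    (𝓕 : Finset (Finset ℕ)) (h𝓕 : DWise.IsMaximalNontrivial n k d 𝓕)
    (hcard : ((k : ℝ) - (d : ℝ) - 1 / 2) * ((n - d).choose (k - d) : ℝ) < (#𝓕 : ℝ)) :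
    (k = 5 ∧ d = 3 →
      DWise.Iso n 𝓕 (DWise.H n k d 2) ∨ DWise.Iso n 𝓕 (DWise.H n k d (k - d)) ∨
      DWise.Iso n 𝓕 (DWise.H n k d (k - d + 1)) ∨ DWise.Iso n 𝓕 (DWise.H n k d (k - d + 2)) ∨
      DWise.Iso n 𝓕 (DWise.G n k d) ∨ DWise.Iso n 𝓕 (DWise.S n k) ∨
      DWise.Iso n 𝓕 (DWise.S₁ n k)) ∧
    ((k = 6 ∨ k = 7) ∧ d = 3 →
      DWise.Iso n 𝓕 (DWise.H n k d 2) ∨ DWise.Iso n 𝓕 (DWise.H n k d (k - d)) ∨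
      DWise.Iso n 𝓕 (DWise.H n k d (k - d + 1)) ∨ DWise.Iso n 𝓕 (DWise.H n k d (k - d + 2)) ∨
      DWise.Iso n 𝓕 (DWise.G n k d) ∨ DWise.Iso n 𝓕 (DWise.S n k) ∨
      DWise.Iso n 𝓕 (DWise.S₁ n k) ∨ DWise.Iso n 𝓕 (DWise.S₂ n k) ∨
      DWise.Iso n 𝓕 (DWise.S₃ n k)) ∧
    (7 < k ∧ d = 3 →
      DWise.Iso n 𝓕 (DWise.H n k d (k - d)) ∨ DWise.Iso n 𝓕 (DWise.H n k d (k - d + 1)) ∨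
      DWise.Iso n 𝓕 (DWise.H n k d (k - d + 2)) ∨ DWise.Iso n 𝓕 (DWise.G n k d) ∨
      DWise.Iso n 𝓕 (DWise.S n k) ∨ DWise.Iso n 𝓕 (DWise.S₁ n k) ∨
      DWise.Iso n 𝓕 (DWise.S₂ n k) ∨ DWise.Iso n 𝓕 (DWise.S₃ n k)) ∧
    (d + 2 ≤ k ∧ k ≤ 2 * d + 1 ∧ 3 < d →
      DWise.Iso n 𝓕 (DWise.H n k d 2) ∨ DWise.Iso n 𝓕 (DWise.H n k d (k - d)) ∨
      DWise.Iso n 𝓕 (DWise.H n k d (k - d + 1)) ∨ DWise.Iso n 𝓕 (DWise.H n k d (k - d + 2)) ∨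
      DWise.Iso n 𝓕 (DWise.G n k d)) ∧
    (2 * d + 1 < k ∧ 3 < d →
      DWise.Iso n 𝓕 (DWise.H n k d (k - d)) ∨ DWise.Iso n 𝓕 (DWise.H n k d (k - d + 1)) ∨
      DWise.Iso n 𝓕 (DWise.H n k d (k - d + 2)) ∨ DWise.Iso n 𝓕 (DWise.G n k d)) := by
  have hpow : d + 2 * (k - d) * k ^ (d + 1) ≤ n :=
    (Nat.add_le_add_left (DWise.two_mul_pow_le hk) d).trans hn.le
  have hkn : 2 * k ≤ n := by
    have h1 : k ≤ k ^ (d + 1) := Nat.le_self_pow (by omega) k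
    have h2 : 2 * 1 * k ≤ 2 * (k - d) * k ^ (d + 1) :=
      Nat.mul_le_mul (Nat.mul_le_mul_left 2 (by omega)) h1
    omega
  have hc := DWise.le_card_smallCovers h𝓕 (by omega) hk hpow hcard
  rcases h𝓕.classification (by omega) hk hkn hc with ⟨hk2, h2⟩ | ⟨X, Y, hXY⟩
  · refine ⟨fun _ => Or.inl h2, fun _ => Or.inl h2, fun _ => ?_, fun _ => Or.inl h2, fun _ => ?_⟩
    · omega
    · omega
  · have hcl := hXY.classification (by omega)
    rcases hcl with h | h | h | h | ⟨h3, h | h | ⟨h6, h | h⟩⟩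
    all_goals
      refine ⟨fun hkd => ?_, fun hkd => ?_, fun hkd => ?_, fun hkd => ?_, fun hkd => ?_⟩ <;>
        first
        | simp only [h, true_or, or_true]
        | omega
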